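/- For $a,b,c\in\mathbb{C}$ with $c\notin\mathbb{Z}_{\le 0}$ let $F(a,b,c\,|\,z)$ denote the Gauss hypergeometric function: the analytic continuation to $\mathbb{C}\setminus[1,\infty)$ of the power series $\sum_{n\ge 0}\frac{(a)_n(b)_n}{(c)_n\,n!}z^n$, $|z|<1$, where $(x)_n=x(x+1)\cdots(x+n-1)$. Then for every $t\in\mathbb{C}$ the function $F(3t,t+\tfrac16,\tfrac12\,|\,z)$ is defined on $\mathbb{C}\setminus[1,\infty)$, and $$F\big(3t,\,t+\tfrac16,\,\tfrac12\,\big|\,-3\big)=\frac{\cos(\pi t)}{16^{t}}\;\frac{\Gamma(t+\tfrac12)\,\Gamma(\tfrac13)}{\Gamma(t+\tfrac13)\,\Gamma(\tfrac12)}.$$ Here $1/\Gamma$ is understood as $0$ at the poles of $\Gamma$, and at the points $t=-\tfrac12-n$ ($n\in\mathbb{Z}_{\ge 0}$), where $\cos(\pi t)$ vanishes and $\Gamma(t+\tfrac12)$ has a simple pole, the right-hand side is understood as its limit $\lim_{s\to t,\,s\ne t}$ (a removable singularity). -/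

import Mathlib

open Complex Filter Topology

/-- The cut plane `ℂ ∖ [1, ∞)`. -/
def cutPlane : Set ℂ := {z : ℂ | ∀ x : ℝ, 1 ≤ x → z ≠ (x : ℂ)}

/-- `G` is an analytic continuation to `ℂ ∖ [1, ∞)` of the Gauss hypergeometric series
`∑ (a)ₙ (b)ₙ / ((c)ₙ n!) zⁿ`, `|z| < 1` (the series is Mathlib's `₂F₁`). -/
def IsGaussContinuation (a b c : ℂ) (G : ℂ → ℂ) : Prop :=
  DifferentiableOn ℂ G cutPlane ∧ ∀ z : ℂ, ‖z‖ < 1 → G z = ₂F₁ a b c z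

open Classical in
/-- The Gauss hypergeometric function `F(a, b, c | z)` for `z ∈ ℂ ∖ [1, ∞)`: the value at `z` of the
analytic continuation of the hypergeometric series to the cut plane (which is unique, see
`IsGaussContinuation.eqOn`). The value `0` is used only if there is no such continuation. -/
noncomputable def gaussF (a b c z : ℂ) : ℂ :=
  if h : ∃ G : ℂ → ℂ, IsGaussContinuation a b c G then h.choose z else 0

theorem cutPlane_eq : cutPlane = {z : ℂ | 1 - z ∈ slitPlane} := by
  ext z
  simp only [cutPlane, Set.mem_ofPred_eq, mem_slitPlane_iff, sub_re, one_re, sub_im, one_im]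
  constructor
  · intro h
    by_contra hz
    push Not at hz
    exact h z.re (by linarith [hz.1]) (Complex.ext (by simp) (by simpa using hz.2))
  · rintro h x hx rfl
    simp at h
    linarith

theorem isOpen_cutPlane : IsOpen cutPlane := by
  rw [cutPlane_eq]
  exact isOpen_slitPlane.preimage (by fun_prop)

theorem isPreconnected_cutPlane : IsPreconnected cutPlane := by
  have h : cutPlane = (fun w : ℂ => 1 - w) '' slitPlane := by
    rw [cutPlane_eq]
    ext z
    constructor
    · intro hz
      exact ⟨1 - z, hz, by ring⟩
    · rintro ⟨w, hw, rfl⟩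
      simpa using hw
  rw [h]
  exact (starConvex_one_slitPlane.isPathConnected one_mem_slitPlane).isConnected.isPreconnected.image _ (by fun_prop)

/-- The analytic continuation to the cut plane is unique. -/
theorem IsGaussContinuation.eqOn {a b c : ℂ} {G H : ℂ → ℂ}
    (hG : IsGaussContinuation a b c G) (hH : IsGaussContinuation a b c H) :
    Set.EqOn G H cutPlane := by
  refine (hG.1.analyticOnNhd isOpen_cutPlane).eqOn_of_preconnected_of_eventuallyEq
    (hH.1.analyticOnNhd isOpen_cutPlane) isPreconnected_cutPlane (z₀ := 0) ?_ ?_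
  · rw [cutPlane_eq]
    simp
  · filter_upwards [Metric.ball_mem_nhds (0 : ℂ) one_pos] with z hz
    have hz' : ‖z‖ < 1 := by simpa using hz
    rw [hG.2 z hz', hH.2 z hz']

theorem IsGaussContinuation.gaussF_eq {a b c z : ℂ} {G : ℂ → ℂ}
    (hG : IsGaussContinuation a b c G) (hz : z ∈ cutPlane) : gaussF a b c z = G z := by
  have h : ∃ G : ℂ → ℂ, IsGaussContinuation a b c G := ⟨G, hG⟩
  rw [gaussF, dif_pos h]
  exact h.choose_spec.eqOn hG hz

/-! Writing cos(πt)Γ(t+1/2) as π/Γ(1/2-t) makes the right-hand side entire in t. The left-hand side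
is entire too, so by the identity theorem it suffices to treat Re t > 1 (`gaussF_neg_three`).

For Re t > 1 put a = 3t, b = t+1/6, c = 2t-2/3. The even part of (1-x)^(-2a) is F(a, a+1/2, 1/2 |
x²). Take x = iy√u and integrate termwise against u^(b-1)(1-u)^c: the upper parameter a+1/2 cancels
against the new lower parameter b+c+1 = a+1/2, and a multiple of F(a, b, 1/2 | -y²) remains
(`integral_one_add_cpow_eq`). At y = √3 substitute u = tan²θ/3. Since sin 3θ = cos³θ tan θ (3 -
tan²θ), all powers of tan θ and cos θ cancel, leaving a multiple of the integral of sin(3θ)^c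
cos(6tθ) over [0, π/3] (`integrand_tan_substitution`).

The frequency 6t = 3c+2 is the one accessible to Cauchy's theorem: integrate (1-x³)^c along an arc
of the unit circle joining two cube roots of unity. By the cubic symmetry both radial integrals
reduce to one Beta integral (`integral_sin_cpow_mul_exp_add_exp`). The triplication and duplication
formulas then turn the Beta quotient into the required Gamma quotient
(`gaussF_neg_three_of_one_lt_re`).

The continuation in z and the holomorphy in t both come from z = 4w/(1+w)², which identifies the
unit disc with the cut plane. In the variable w, (1+w)^(-2a) F has coefficients given by a
three-term recurrence. They are polynomial in a and b and grow at most polynomially, locally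
uniformly in a and b, so the series converges for |w| < 1 (`isGaussContinuation_discSum`,
`differentiable_gaussF`). -/

/-! ### Calculus of power series with explicit coefficients -/

/-- `f` is the sum of the power series `∑ p n * z ^ n` on the disc `‖z‖ < r`. -/
def IsSeriesOn (p : ℕ → ℂ) (f : ℂ → ℂ) (r : ℝ) : Prop :=
  ∀ z : ℂ, ‖z‖ < r → HasSum (fun n => p n * z ^ n) (f z)

namespace IsSeriesOn

variable {p q : ℕ → ℂ} {f g : ℂ → ℂ} {r : ℝ}

theorem hasFPowerSeriesOnBall (h : IsSeriesOn p f r) (hr : 0 < r) :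
    HasFPowerSeriesOnBall f (FormalMultilinearSeries.ofScalars ℂ p) 0 (ENNReal.ofReal r) where
  r_le := by
    refine ENNReal.le_of_forall_nnreal_lt fun s hs => ?_
    have hs' : (s : ℝ) < r := by
      rw [← ENNReal.ofReal_coe_nnreal] at hs
      exact (ENNReal.ofReal_lt_ofReal_iff hr).1 hs
    have hz := h (s : ℝ) (by simpa using hs')
    refine FormalMultilinearSeries.le_radius_of_tendsto _ (l := 0) ?_
    simpa using hz.summable.tendsto_atTop_zero.norm
  r_pos := by simpa using hr
  hasSum := by
    intro y hy
    rw [Metric.eball_ofReal] at hy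
    have := h y (by simpa using hy)
    simpa [FormalMultilinearSeries.ofScalars_apply_eq, mul_comm] using this

theorem differentiableOn (h : IsSeriesOn p f r) : DifferentiableOn ℂ f (Metric.ball 0 r) := by
  rcases le_or_gt r 0 with hr | hr
  · rw [Metric.ball_eq_empty.2 hr]
    exact differentiableOn_empty
  · have := (h.hasFPowerSeriesOnBall hr).differentiableOn
    rwa [Metric.eball_ofReal] at this

theorem unique (h : IsSeriesOn p f r) (h' : IsSeriesOn q f r) (hr : 0 < r) : p = q :=
  FormalMultilinearSeries.ofScalars_series_injective ℂ ℂ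
    ((h.hasFPowerSeriesOnBall hr).hasFPowerSeriesAt.eq_formalMultilinearSeries
      (h'.hasFPowerSeriesOnBall hr).hasFPowerSeriesAt)

theorem congr (h : IsSeriesOn p f r) (hfg : ∀ z, ‖z‖ < r → f z = g z) : IsSeriesOn p g r :=
  fun z hz => hfg z hz ▸ h z hz

theorem taylor (hf : DifferentiableOn ℂ f (Metric.ball 0 r)) :
    IsSeriesOn (fun n => (n.factorial : ℂ)⁻¹ * iteratedDeriv n f 0) f r := by
  intro z hz
  have := Complex.hasSum_taylorSeries_on_ball hf (z := z) (by simpa using hz)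
  refine HasSum.congr_fun this ?_
  intro n
  simp only [sub_zero, smul_eq_mul]
  ring

theorem deriv (h : IsSeriesOn p f r) :
    IsSeriesOn (fun n => (n + 1) * p (n + 1)) (deriv f) r := by
  rcases le_or_gt r 0 with hr | hr
  · exact fun z hz => absurd (hz.trans_le hr) (norm_nonneg z).not_gt
  · have hp := h.unique (taylor h.differentiableOn) hr
    have hd := taylor (h.differentiableOn.deriv Metric.isOpen_ball)
    convert hd using 2 with n
    rw [hp]
    simp only [Nat.factorial_succ, iteratedDeriv_succ']
    push_cast
    field_simp

theorem add (h : IsSeriesOn p f r) (h' : IsSeriesOn q g r) :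
    IsSeriesOn (fun n => p n + q n) (fun z => f z + g z) r := fun z hz => by
  simpa [add_mul] using (h z hz).add (h' z hz)

theorem const_mul (h : IsSeriesOn p f r) (k : ℂ) :
    IsSeriesOn (fun n => k * p n) (fun z => k * f z) r := fun z hz => by
  simpa [mul_assoc] using (h z hz).mul_left k

theorem id_mul (h : IsSeriesOn p f r) :
    IsSeriesOn (fun n => if n = 0 then 0 else p (n - 1)) (fun z => z * f z) r := fun z hz => by
  rw [← hasSum_nat_add_iff' 1]
  have := (h z hz).mul_left z
  simp only [Nat.add_eq_zero_iff, one_ne_zero, and_false, if_false, Nat.add_sub_cancel,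
    Finset.range_one, Finset.sum_singleton, if_true, zero_mul, sub_zero]
  refine HasSum.congr_fun this ?_
  intro n
  ring

theorem theta (h : IsSeriesOn p f r) :
    IsSeriesOn (fun n => n * p n) (fun z => z * _root_.deriv f z) r := by
  convert h.deriv.id_mul using 2 with n
  rcases n with _ | n <;> simp

theorem coeff_zero (h : IsSeriesOn p f r) (hr : 0 < r) : p 0 = f 0 := by
  have h1 := h 0 (by simpa using hr)
  have h2 := hasSum_single (f := fun n => p n * (0 : ℂ) ^ n) 0 (by intro n hn; simp [hn])
  simpa using (h1.unique h2).symm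

end IsSeriesOn

theorem isSeriesOn_zero (r : ℝ) : IsSeriesOn (fun _ => 0) (fun _ => 0) r := fun z _ => by
  simp

/-! ### The hypergeometric series and its differential equation -/

theorem isSeriesOn_ordinaryHypergeometric (a b c : ℂ) :
    IsSeriesOn (ordinaryHypergeometricCoefficient a b c) (₂F₁ a b c) 1 := by
  have hrad : 1 ≤ (ordinaryHypergeometricSeries ℂ a b c).radius := by
    -- In the exceptional case all late coefficients vanish (for -c a natural number because `0⁻¹ =
    -- 0`), so the radius is infinite.
    by_cases h : ∀ k : ℕ, (k : ℂ) ≠ -a ∧ (k : ℂ) ≠ -b ∧ (k : ℂ) ≠ -c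
    · exact (ordinaryHypergeometricSeries_radius_eq_one ℂ a b c h).ge
    · push Not at h
      obtain ⟨k, hk⟩ := h
      refine le_of_le_of_eq le_top (Eq.symm ?_)
      refine FormalMultilinearSeries.radius_eq_top_of_forall_image_add_eq_zero _ (1 + k) fun n ↦ ?_
      exact ordinaryHypergeometricSeries_eq_zero_of_neg_nat a b c (k := k) (by tauto) (by lia)
  intro z hz
  have hz' : z ∈ Metric.eball (0 : ℂ) (ordinaryHypergeometricSeries ℂ a b c).radius := by
    refine Metric.eball_subset_eball hrad ?_
    rw [← ENNReal.ofReal_one, Metric.eball_ofReal]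
    simpa using hz
  have := FormalMultilinearSeries.hasSum (ordinaryHypergeometricSeries ℂ a b c) hz'
  simp only [ordinaryHypergeometricSeries_apply_eq, smul_eq_mul] at this
  exact this

theorem ordinaryHypergeometricCoefficient_succ (a b c : ℂ) (n : ℕ) (hc : c + n ≠ 0) :
    (n + 1) * (c + n) * ordinaryHypergeometricCoefficient a b c (n + 1) =
      (a + n) * (b + n) * ordinaryHypergeometricCoefficient a b c n := by
  simp only [ordinaryHypergeometricCoefficient, ascPochhammer_succ_eval, Nat.factorial_succ,
    Nat.cast_mul, Nat.cast_add, Nat.cast_one, mul_inv]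
  have hn : (n : ℂ) + 1 ≠ 0 := Nat.cast_add_one_ne_zero n
  field_simp

/-- The hypergeometric differential equation in terms of `θ = z d/dz`. -/
theorem ordinaryHypergeometric_ode (a b c : ℂ) (hc : ∀ n : ℕ, c + n ≠ 0) {f₁ f₂ : ℂ → ℂ}
    (h₁ : f₁ = fun z => z * deriv (₂F₁ a b c) z) (h₂ : f₂ = fun z => z * deriv f₁ z)
    {z : ℂ} (hz : ‖z‖ < 1) :
    f₂ z + (c - 1) * f₁ z = z * (f₂ z + (a + b) * f₁ z + a * b * ₂F₁ a b c z) := by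
  have hf := isSeriesOn_ordinaryHypergeometric a b c
  have hf₁ := hf.theta
  rw [← h₁] at hf₁
  have hf₂ := hf₁.theta
  rw [← h₂] at hf₂
  have hl := hf₂.add (hf₁.const_mul (c - 1))
  have hr := ((hf₂.add (hf₁.const_mul (a + b))).add (hf.const_mul (a * b))).id_mul
  refine (hl z hz).unique ?_
  refine HasSum.congr_fun (hr z hz) fun n => ?_
  congr 1
  rcases n with _ | n
  · simp
  · have := ordinaryHypergeometricCoefficient_succ a b c n (hc n)
    simp only [Nat.add_eq_zero_iff, one_ne_zero, and_false, if_false, Nat.add_sub_cancel]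
    push_cast
    linear_combination this

/-! ### Expansion in the disc coordinate -/

/-- The coefficients in `w` of `(1 + w) ^ (-2 a) * F(a, b, c | 4 w / (1 + w) ^ 2)`. -/
noncomputable def discCoeff (a b c : ℂ) : ℕ → ℂ
  | 0 => 1
  | 1 => 2 * (2 * b - c) * a / c
  | n + 2 => (2 * (2 * b - c) * (n + 1 + a) * discCoeff a b c (n + 1) +
      (n + 2 * a) * (n + 1 + 2 * a - c) * discCoeff a b c n) / ((n + 2) * (n + 1 + c))

theorem eq_discCoeff {a b c : ℂ} (hc : ∀ n : ℕ, c + n ≠ 0) {q : ℕ → ℂ} (h0 : q 0 = 1)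
    (h1 : c * q 1 = 2 * (2 * b - c) * a * q 0)
    (h2 : ∀ n : ℕ, (n + 2) * (n + 1 + c) * q (n + 2) =
      2 * (2 * b - c) * (n + 1 + a) * q (n + 1) + (n + 2 * a) * (n + 1 + 2 * a - c) * q n) :
    ∀ n, q n = discCoeff a b c n := by
  have hc0 : c ≠ 0 := by simpa using hc 0
  have key : ∀ n, q n = discCoeff a b c n ∧ q (n + 1) = discCoeff a b c (n + 1) := by
    intro n
    induction n with
    | zero =>
      refine ⟨by simp [discCoeff, h0], ?_⟩
      rw [discCoeff, eq_div_iff hc0]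
      linear_combination h1 + 2 * (2 * b - c) * a * h0
    | succ n ih =>
      refine ⟨ih.2, ?_⟩
      have hn : (n : ℂ) + 1 + 1 ≠ 0 := by exact_mod_cast Nat.succ_ne_zero (n + 1)
      have hn' : (n : ℂ) + 1 + c ≠ 0 := by
        have := hc (n + 1)
        push_cast at this
        rwa [add_comm]
      have h2n : (n : ℂ) + 2 ≠ 0 := by
        intro h
        exact hn (by linear_combination h)
      rw [discCoeff, eq_div_iff (mul_ne_zero h2n hn'), ← ih.1, ← ih.2]
      linear_combination h2 n
  exact fun n => (key n).1

/-- The radius 1/8 is only a convenient choice: a neighbourhood of 0 suffices for the later identity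
theorem. -/
theorem norm_four_mul_div_lt_one {w : ℂ} (hw : ‖w‖ < 1 / 8) : ‖4 * w / (1 + w) ^ 2‖ < 1 := by
  have h1 : 7 / 8 ≤ ‖1 + w‖ := by
    have := norm_sub_norm_le (1 : ℂ) (-w)
    rw [sub_neg_eq_add, norm_neg, norm_one] at this
    linarith
  rw [norm_div, norm_mul, norm_pow, div_lt_one (by positivity)]
  simp only [Complex.norm_ofNat]
  nlinarith

theorem hasDerivAt_discMap {w : ℂ} (hw : 1 + w ≠ 0) :
    HasDerivAt (fun w : ℂ => 4 * w / (1 + w) ^ 2) (4 * (1 - w) / (1 + w) ^ 3) w := by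
  have h1 : HasDerivAt (fun w : ℂ => 4 * w) 4 w := by
    simpa using (hasDerivAt_id w).const_mul (4 : ℂ)
  have h2 : HasDerivAt (fun w : ℂ => (1 + w) ^ 2) (2 * (1 + w)) w := by
    simpa using! ((hasDerivAt_id w).const_add 1).pow 2
  refine (h1.div h2 (pow_ne_zero 2 hw)).congr_deriv ?_
  field_simp
  ring

/-- `(1 + w) ^ (-2 a) * F(a, b, c | 4 w / (1 + w) ^ 2)` as a power series in `w`. -/
theorem isSeriesOn_discCoeff (a b c : ℂ) (hc : ∀ n : ℕ, c + n ≠ 0) :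
    IsSeriesOn (discCoeff a b c)
      (fun w => (1 + w) ^ (-2 * a) * ₂F₁ a b c (4 * w / (1 + w) ^ 2)) (1 / 8) := by
  set f : ℂ → ℂ := ₂F₁ a b c with hfdef
  set f₁ : ℂ → ℂ := fun z => z * deriv f z with h₁
  set f₂ : ℂ → ℂ := fun z => z * deriv f₁ z with h₂
  have hf := isSeriesOn_ordinaryHypergeometric a b c
  have hdf : ∀ z : ℂ, ‖z‖ < 1 → DifferentiableAt ℂ f z := fun z hz =>
    hf.differentiableOn.differentiableAt (Metric.isOpen_ball.mem_nhds (by simpa using hz))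
  have hdf₁ : ∀ z : ℂ, ‖z‖ < 1 → DifferentiableAt ℂ f₁ z := fun z hz =>
    hf.theta.differentiableOn.differentiableAt (Metric.isOpen_ball.mem_nhds (by simpa using hz))
  have hne : ∀ w : ℂ, ‖w‖ < 1 / 8 → 1 + w ∈ slitPlane := fun w hw =>
    mem_slitPlane_of_norm_lt_one (hw.trans (by norm_num))
  set u : ℂ → ℂ := fun w => 4 * w / (1 + w) ^ 2 with hu
  set E : ℂ → ℂ := fun w => (1 + w) ^ (-2 * a) with hE
  have hEd : ∀ w : ℂ, ‖w‖ < 1 / 8 → HasDerivAt E (E w * (-2 * a / (1 + w))) w := by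
    intro w hw
    have h0 := slitPlane_ne_zero (hne w hw)
    have := ((hasDerivAt_id w).const_add 1).cpow_const (c := -2 * a) (hne w hw)
    refine this.congr_deriv ?_
    simp only [id, mul_one]
    rw [Complex.cpow_sub _ _ h0, Complex.cpow_one]
    simp only [hE]
    field_simp
  have hcomp : ∀ g : ℂ → ℂ, (∀ z : ℂ, ‖z‖ < 1 → DifferentiableAt ℂ g z) → ∀ w : ℂ, ‖w‖ < 1 / 8 →
      HasDerivAt (fun w => g (u w)) (deriv g (u w) * (4 * (1 - w) / (1 + w) ^ 3)) w := by
    intro g hg w hw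
    exact (hg _ (norm_four_mul_div_lt_one hw)).hasDerivAt.comp w
      (hasDerivAt_discMap (slitPlane_ne_zero (hne w hw)))
  set h : ℂ → ℂ := fun w => E w * f (u w) with hh
  have hd0 : ∀ w : ℂ, ‖w‖ < 1 / 8 → HasDerivAt h (E w * (-2 * a / (1 + w)) * f (u w) +
      E w * (deriv f (u w) * (4 * (1 - w) / (1 + w) ^ 3))) w := fun w hw =>
    (hEd w hw).mul (hcomp f hdf w hw)
  -- This is θh for θ = w d/dw, written through f and θf at u(w), using θ(u) = u(1-w)/(1+w).
  set k : ℂ → ℂ := fun w => E w * (-2 * a * w / (1 + w) * f (u w) + (1 - w) / (1 + w) * f₁ (u w))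
    with hk
  have hk1 : ∀ w : ℂ, ‖w‖ < 1 / 8 → w * deriv h w = k w := by
    intro w hw
    have h0 := slitPlane_ne_zero (hne w hw)
    rw [(hd0 w hw).deriv]
    simp only [hk, h₁]
    rw [show u w = 4 * w / (1 + w) ^ 2 from rfl]
    field_simp
  have hα : ∀ w : ℂ, 1 + w ≠ 0 →
      HasDerivAt (fun w : ℂ => -2 * a * w / (1 + w)) (-2 * a / (1 + w) ^ 2) w := by
    intro w hw
    have := ((hasDerivAt_id w).const_mul (-2 * a)).div ((hasDerivAt_id w).const_add 1) hw
    refine this.congr_deriv ?_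
    simp only [id]
    field_simp
    ring
  have hβ : ∀ w : ℂ, 1 + w ≠ 0 →
      HasDerivAt (fun w : ℂ => (1 - w) / (1 + w)) (-2 / (1 + w) ^ 2) w := by
    intro w hw
    have := ((hasDerivAt_id w).const_sub 1).div ((hasDerivAt_id w).const_add 1) hw
    refine this.congr_deriv ?_
    simp only [id]
    field_simp
    ring
  have hk2 : ∀ w : ℂ, ‖w‖ < 1 / 8 → w * deriv k w = E w * (-2 * a * w / (1 + w) *
      (-2 * a * w / (1 + w) * f (u w) + (1 - w) / (1 + w) * f₁ (u w)) +
      (-2 * a * w / (1 + w) ^ 2 * f (u w) + -2 * a * w / (1 + w) * ((1 - w) / (1 + w)) * f₁ (u w)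
      + -2 * w / (1 + w) ^ 2 * f₁ (u w) + ((1 - w) / (1 + w)) ^ 2 * f₂ (u w))) := by
    intro w hw
    have h0 := slitPlane_ne_zero (hne w hw)
    have hd := (hEd w hw).mul (((hα w h0).mul (hcomp f hdf w hw)).add
      ((hβ w h0).mul (hcomp f₁ hdf₁ w hw)))
    have hd' : HasDerivAt k _ w := hd
    rw [hd'.deriv]
    have e1 : f₂ (u w) = u w * deriv f₁ (u w) := rfl
    have e2 : f₁ (u w) = u w * deriv f (u w) := rfl
    simp only [Pi.add_apply, Pi.mul_apply]
    rw [e1, e2]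
    generalize deriv f₁ (u w) = d1
    generalize deriv f (u w) = d0
    generalize f (u w) = d
    generalize E w = e
    rw [show u w = 4 * w / (1 + w) ^ 2 from rfl]
    field_simp
    ring
  -- The hypergeometric equation pulled back to w. Its coefficients are polynomials in w of degree
  -- at most 2, hence a three-term recurrence; the nested products by w match iterated `id_mul`.
  have hode : ∀ w : ℂ, ‖w‖ < 1 / 8 → (w * deriv k w - w * (w * (w * deriv k w))) +
      ((c - 1) * k w + (2 * c - 4 * b) * (w * k w) + (c - 1 - 4 * a) * (w * (w * k w))) +
      (2 * a * (c - 2 * b) * (w * h w) + 2 * a * (c - 1 - 2 * a) * (w * (w * h w))) = 0 := by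
    intro w hw
    have h0 := slitPlane_ne_zero (hne w hw)
    have hz := ordinaryHypergeometric_ode a b c hc h₁ h₂ (norm_four_mul_div_lt_one hw)
    rw [hk2 w hw]
    simp only [hk, hh]
    rw [← hfdef] at hz
    change f₂ (u w) + (c - 1) * f₁ (u w) =
      u w * (f₂ (u w) + (a + b) * f₁ (u w) + a * b * f (u w)) at hz
    generalize f₂ (u w) = y2 at *
    generalize f₁ (u w) = y1 at *
    generalize f (u w) = y0 at *
    generalize E w = e at *
    rw [show u w = 4 * w / (1 + w) ^ 2 from rfl] at hz
    have hz2 : (1 + w) ^ 2 * (y2 + (c - 1) * y1) = 4 * w * (y2 + (a + b) * y1 + a * b * y0) := by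
      rw [hz]
      field_simp
    field_simp
    linear_combination e * (1 - w) * (1 + w) * hz2
  have hdiff : DifferentiableOn ℂ h (Metric.ball 0 (1 / 8)) := fun w hw =>
    (hd0 w (by simpa using hw)).differentiableAt.differentiableWithinAt
  obtain ⟨q, hq⟩ : ∃ q, IsSeriesOn q h (1 / 8) := ⟨_, IsSeriesOn.taylor hdiff⟩
  have hqk := hq.theta.congr hk1
  have hqk2 := hqk.theta
  have hser := (((hqk2.add (hqk2.id_mul.id_mul.const_mul (-1))).add
    (((hqk.const_mul (c - 1)).add (hqk.id_mul.const_mul (2 * c - 4 * b))).add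
      (hqk.id_mul.id_mul.const_mul (c - 1 - 4 * a)))).add
    ((hq.id_mul.const_mul (2 * a * (c - 2 * b))).add
      (hq.id_mul.id_mul.const_mul (2 * a * (c - 1 - 2 * a))))).congr (g := fun _ => 0)
      (fun w hw => by rw [← hode w hw]; ring)
  have hzero := hser.unique (isSeriesOn_zero _) (by norm_num)
  have hq0 : q 0 = 1 := by
    rw [hq.coeff_zero (by norm_num)]
    simp [hh, hE, hu, hfdef]
  have hqeq : q = discCoeff a b c := by
    funext n
    refine eq_discCoeff hc hq0 ?_ ?_ n
    · have := congrFun hzero 1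
      simp at this
      linear_combination this
    · intro n
      have := congrFun hzero (n + 2)
      simp at this
      linear_combination this
  rwa [← hqeq]

/-! ### Convergence in the unit disc and dependence on the parameters -/

/-- In the recurrence the factor of the older coefficient is n² + O(n) and that of the newer one is
O(n), against a denominator n² + O(n). With an increasing majorant each step therefore costs a
factor 1 + O(1/n), uniformly for parameters bounded by R. -/
theorem norm_discCoeff_le {a b : ℂ} {R : ℝ} (ha : ‖a‖ ≤ R) (hb : ‖b‖ ≤ R) (n : ℕ) :
    ‖discCoeff a b (1 / 2) n‖ ≤ ∏ i ∈ Finset.range n, (1 + 8 * (R + 1) ^ 2 / ((i : ℝ) + 1)) := by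
  have hR : 0 ≤ R := (norm_nonneg a).trans ha
  set M : ℕ → ℝ := fun n => ∏ i ∈ Finset.range n, (1 + 8 * (R + 1) ^ 2 / ((i : ℝ) + 1)) with hM
  have hMs : ∀ n, M (n + 1) = M n * (1 + 8 * (R + 1) ^ 2 / ((n : ℝ) + 1)) := fun n =>
    Finset.prod_range_succ _ _
  have hMpos : ∀ n, 0 < M n := fun n => Finset.prod_pos fun i _ => by positivity
  have hb2 : ‖2 * b - 1 / 2‖ ≤ 2 * R + 1 := by
    refine (norm_sub_le _ _).trans ?_
    rw [norm_mul]
    norm_num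
    linarith
  have key : ∀ n, ‖discCoeff a b (1 / 2) n‖ ≤ M n ∧ ‖discCoeff a b (1 / 2) (n + 1)‖ ≤ M (n + 1) := by
    intro n
    induction n with
    | zero =>
      refine ⟨by simp [discCoeff, hM], ?_⟩
      have h1 : ‖discCoeff a b (1 / 2) 1‖ = 4 * ‖2 * b - 1 / 2‖ * ‖a‖ := by
        rw [discCoeff, norm_div, norm_mul, norm_mul]
        norm_num
        ring
      have h2 : M (0 + 1) = 1 + 8 * (R + 1) ^ 2 := by simp [hM]
      rw [h2, zero_add, h1]
      have := mul_le_mul hb2 ha (norm_nonneg _) (by positivity)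
      nlinarith
    | succ n ih =>
      refine ⟨ih.2, ?_⟩
      obtain ⟨h0, h1⟩ := ih
      have hle : M n ≤ M (n + 1) := by
        rw [hMs]
        exact le_mul_of_one_le_right (hMpos n).le (le_add_of_nonneg_right (by positivity))
      have e1 : ‖(n : ℂ) + 2‖ = n + 2 := by
        rw [show (n : ℂ) + 2 = ((n + 2 : ℝ) : ℂ) by push_cast; ring, Complex.norm_real,
          Real.norm_of_nonneg (by positivity)]
      have e2 : ‖(n : ℂ) + 1 + 1 / 2‖ = n + 3 / 2 := by
        rw [show (n : ℂ) + 1 + 1 / 2 = ((n + 3 / 2 : ℝ) : ℂ) by push_cast; ring, Complex.norm_real,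
          Real.norm_of_nonneg (by positivity)]
      have e3 : ‖(n : ℂ) + 1 + a‖ ≤ (1 + R) * (n + 3 / 2) := by
        have : ‖(n : ℂ) + 1‖ = n + 1 := by exact_mod_cast Complex.norm_natCast (n + 1)
        have h := norm_add_le ((n : ℂ) + 1) a
        have hn : (0 : ℝ) ≤ n := Nat.cast_nonneg n
        nlinarith
      have e4 : ‖(n : ℂ) + 2 * a‖ ≤ n + 2 * R := by
        have h := norm_add_le (n : ℂ) (2 * a)
        rw [Complex.norm_natCast, norm_mul, Complex.norm_ofNat] at h
        linarith
      have e5 : ‖(n : ℂ) + 1 + 2 * a - 1 / 2‖ ≤ n + 3 / 2 + 2 * R := by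
        rw [show (n : ℂ) + 1 + 2 * a - 1 / 2 = ((n + 1 / 2 : ℝ) : ℂ) + 2 * a by push_cast; ring]
        have h := norm_add_le ((n + 1 / 2 : ℝ) : ℂ) (2 * a)
        rw [Complex.norm_real, Real.norm_of_nonneg (by positivity), norm_mul,
          Complex.norm_ofNat] at h
        linarith
      rw [discCoeff, norm_div, norm_mul, e1, e2, div_le_iff₀ (by positivity)]
      refine (norm_add_le _ _).trans ?_
      rw [norm_mul, norm_mul, norm_mul, norm_mul, norm_mul, Complex.norm_ofNat]
      have t1 : 2 * ‖2 * b - 1 / 2‖ * ‖(n : ℂ) + 1 + a‖ * ‖discCoeff a b (1 / 2) (n + 1)‖ ≤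
          2 * (2 * R + 1) * ((1 + R) * (n + 3 / 2)) * M (n + 1) := by
        gcongr
      have t2 : ‖(n : ℂ) + 2 * a‖ * ‖(n : ℂ) + 1 + 2 * a - 1 / 2‖ * ‖discCoeff a b (1 / 2) n‖ ≤
          (n + 2 * R) * (n + 3 / 2 + 2 * R) * M (n + 1) := by
        gcongr
        exact h0.trans hle
      have t3 : M (n + 1 + 1) * ((n + 2) * (n + 3 / 2)) =
          M (n + 1) * ((n + 2 + 8 * (R + 1) ^ 2) * (n + 3 / 2)) := by
        rw [hMs (n + 1)]
        push_cast
        field_simp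
        ring
      rw [t3]
      refine (add_le_add t1 t2).trans ?_
      rw [← add_mul, mul_comm]
      refine mul_le_mul_of_nonneg_left ?_ (hMpos _).le
      have hn : (0 : ℝ) ≤ n := Nat.cast_nonneg n
      have hnR : 0 ≤ n * R := by positivity
      nlinarith [mul_nonneg hnR hR]
  exact (key n).1

theorem summable_prod_one_add_div_mul_pow {K r : ℝ} (hK : 0 ≤ K) (hr0 : 0 < r) (hr : r < 1) :
    Summable fun n : ℕ => (∏ i ∈ Finset.range n, (1 + K / ((i : ℝ) + 1))) * r ^ n := by
  have hpos : ∀ n : ℕ, 0 < (∏ i ∈ Finset.range n, (1 + K / ((i : ℝ) + 1))) * r ^ n := fun n =>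
    mul_pos (Finset.prod_pos fun i _ => by positivity) (by positivity)
  refine summable_of_ratio_test_tendsto_lt_one hr (Eventually.of_forall fun n => (hpos n).ne') ?_
  have h : Tendsto (fun n : ℕ => (1 + K * (1 / ((n : ℝ) + 1))) * r) atTop (𝓝 ((1 + K * 0) * r)) :=
    ((tendsto_one_div_add_atTop_nhds_zero_nat.const_mul K).const_add 1).mul_const r
  simp only [mul_zero, add_zero, one_mul] at h
  refine h.congr fun n => ?_
  rw [Real.norm_of_nonneg (hpos _).le, Real.norm_of_nonneg (hpos _).le, eq_div_iff (hpos n).ne',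
    Finset.prod_range_succ]
  ring

/-- The sum of the series with coefficients `discCoeff a b (1 / 2)`. -/
noncomputable def discSum (a b w : ℂ) : ℂ := ∑' n, discCoeff a b (1 / 2) n * w ^ n

theorem norm_discCoeff_mul_pow_le {a b w : ℂ} {R r : ℝ} (ha : ‖a‖ ≤ R) (hb : ‖b‖ ≤ R)
    (hw : ‖w‖ ≤ r) (n : ℕ) : ‖discCoeff a b (1 / 2) n * w ^ n‖ ≤
      (∏ i ∈ Finset.range n, (1 + 8 * (R + 1) ^ 2 / ((i : ℝ) + 1))) * r ^ n := by
  rw [norm_mul, norm_pow]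
  exact mul_le_mul (norm_discCoeff_le ha hb n) (pow_le_pow_left₀ (norm_nonneg _) hw n)
    (by positivity) (Finset.prod_nonneg fun i _ => by positivity)

theorem differentiableAt_discSum (a b : ℂ) {w : ℂ} (hw : ‖w‖ < 1) :
    DifferentiableAt ℂ (discSum a b) w := by
  obtain ⟨r, hwr, hr⟩ := exists_between hw
  have hr0 : 0 < r := (norm_nonneg w).trans_lt hwr
  have := Complex.differentiableOn_tsum_of_summable_norm
    (F := fun n w => discCoeff a b (1 / 2) n * w ^ n) (U := Metric.ball 0 r)
    (summable_prod_one_add_div_mul_pow (K := 8 * (max ‖a‖ ‖b‖ + 1) ^ 2) (by positivity) hr0 hr)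
    (fun n => by fun_prop) Metric.isOpen_ball
    (fun n w hw => norm_discCoeff_mul_pow_le (le_max_left _ _) (le_max_right _ _)
      (mem_ball_zero_iff.1 hw).le n)
  exact this.differentiableAt (Metric.isOpen_ball.mem_nhds (by simpa using hwr))

/-- The recurrence divides only by quantities depending on n and c, so each coefficient is
polynomial in a and b. -/
theorem differentiable_discCoeff {a b : ℂ → ℂ} (ha : Differentiable ℂ a) (hb : Differentiable ℂ b)
    (c : ℂ) (n : ℕ) : Differentiable ℂ fun t => discCoeff (a t) (b t) c n := by
  have key : ∀ n, Differentiable ℂ (fun t => discCoeff (a t) (b t) c n) ∧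
      Differentiable ℂ (fun t => discCoeff (a t) (b t) c (n + 1)) := by
    intro n
    induction n with
    | zero =>
      simp only [discCoeff]
      constructor <;> fun_prop
    | succ n ih =>
      obtain ⟨h0, h1⟩ := ih
      refine ⟨h1, ?_⟩
      simp only [discCoeff]
      fun_prop
  exact (key n).1

/-- The majorant depends on the parameters only through R, so convergence is uniform near each t₀.
-/
theorem differentiable_discSum {a b : ℂ → ℂ} (ha : Differentiable ℂ a) (hb : Differentiable ℂ b)
    {w : ℂ} (hw : ‖w‖ < 1) : Differentiable ℂ fun t => discSum (a t) (b t) w := by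
  intro t₀
  obtain ⟨r, hwr, hr⟩ := exists_between hw
  have hr0 : 0 < r := (norm_nonneg w).trans_lt hwr
  set R := max (‖a t₀‖ + 1) (‖b t₀‖ + 1) with hR
  have hR0 : 0 ≤ R := le_max_of_le_left (by positivity)
  set U := {t : ℂ | ‖a t‖ < R} ∩ {t : ℂ | ‖b t‖ < R} with hU
  have hUo : IsOpen U := (isOpen_lt ha.continuous.norm continuous_const).inter
    (isOpen_lt hb.continuous.norm continuous_const)
  have htU : t₀ ∈ U := ⟨lt_max_of_lt_left (lt_add_one ‖a t₀‖),
    lt_max_of_lt_right (lt_add_one ‖b t₀‖)⟩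
  have := Complex.differentiableOn_tsum_of_summable_norm
    (F := fun n t => discCoeff (a t) (b t) (1 / 2) n * w ^ n)
    (summable_prod_one_add_div_mul_pow (K := 8 * (R + 1) ^ 2) (by positivity) hr0 hr)
    (fun n => ((differentiable_discCoeff ha hb _ n).mul_const _).differentiableOn) hUo
    (fun n t ht => norm_discCoeff_mul_pow_le (le_of_lt ht.1) (le_of_lt ht.2) hwr.le n)
  exact this.differentiableAt (hUo.mem_nhds htU)

/-! ### Continuation to the cut plane -/

/-- The inverse of `w ↦ 4 w / (1 + w) ^ 2`, from the cut plane to the unit disc. -/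
noncomputable def toDisc (z : ℂ) : ℂ := (1 - (1 - z) ^ (1 / 2 : ℂ)) / (1 + (1 - z) ^ (1 / 2 : ℂ))

theorem re_cpow_half_pos {z : ℂ} (hz : z ∈ slitPlane) : 0 < (z ^ (1 / 2 : ℂ)).re := by
  rw [Complex.cpow_def_of_ne_zero (slitPlane_ne_zero hz), Complex.exp_re]
  refine mul_pos (Real.exp_pos _) (Real.cos_pos_of_mem_Ioo ?_)
  have him : (Complex.log z * (1 / 2)).im = z.arg / 2 := by
    rw [show (1 / 2 : ℂ) = ((1 / 2 : ℝ) : ℂ) by norm_num, Complex.im_mul_ofReal, Complex.log_im]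
    ring
  rw [him]
  have h1 := Complex.neg_pi_lt_arg z
  have h2 := (Complex.arg_le_pi z).lt_of_ne (mem_slitPlane_iff_arg.1 hz).1
  constructor <;> linarith

theorem one_sub_mem_slitPlane {z : ℂ} (hz : z ∈ cutPlane) : 1 - z ∈ slitPlane := by
  rwa [cutPlane_eq] at hz

theorem one_add_cpow_half_ne_zero {z : ℂ} (hz : z ∈ cutPlane) :
    1 + (1 - z) ^ (1 / 2 : ℂ) ≠ 0 := fun h => by
  have h1 := re_cpow_half_pos (one_sub_mem_slitPlane hz)
  have h2 := congrArg Complex.re h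
  simp only [add_re, one_re, zero_re] at h2
  linarith

/-- The root of 1 - z has positive real part, so it lies closer to 1 than to -1. -/
theorem norm_toDisc_lt_one {z : ℂ} (hz : z ∈ cutPlane) : ‖toDisc z‖ < 1 := by
  have h1 := re_cpow_half_pos (one_sub_mem_slitPlane hz)
  rw [toDisc, norm_div, div_lt_one (norm_pos_iff.2 (one_add_cpow_half_ne_zero hz)),
    ← sq_lt_sq₀ (norm_nonneg _) (norm_nonneg _), Complex.sq_norm, Complex.sq_norm,
    Complex.normSq_apply, Complex.normSq_apply]
  simp only [sub_re, one_re, sub_im, one_im, add_re, add_im]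
  nlinarith

theorem discMap_toDisc {z : ℂ} (hz : z ∈ cutPlane) :
    4 * toDisc z / (1 + toDisc z) ^ 2 = z := by
  have h0 := one_add_cpow_half_ne_zero hz
  have hs : ((1 - z) ^ (1 / 2 : ℂ)) ^ 2 = 1 - z := by
    rw [one_div]
    exact_mod_cast Complex.cpow_nat_inv_pow (1 - z) two_ne_zero
  have h1 : 1 + toDisc z = 2 / (1 + (1 - z) ^ (1 / 2 : ℂ)) := by
    rw [toDisc]
    field_simp
    ring
  rw [h1, toDisc]
  field_simp
  linear_combination -4 * hs

theorem differentiableAt_toDisc {z : ℂ} (hz : z ∈ cutPlane) : DifferentiableAt ℂ toDisc z := by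
  have h : DifferentiableAt ℂ (fun z : ℂ => (1 - z) ^ (1 / 2 : ℂ)) z :=
    ((differentiableAt_id).const_sub 1).cpow_const (one_sub_mem_slitPlane hz)
  exact (h.const_sub 1).div (h.const_add 1) (one_add_cpow_half_ne_zero hz)

theorem ball_subset_cutPlane : Metric.ball (0 : ℂ) 1 ⊆ cutPlane := by
  intro z hz x hx h
  rw [h, mem_ball_zero_iff, Complex.norm_real, Real.norm_of_nonneg (by linarith)] at hz
  linarith

theorem half_add_natCast_ne_zero (n : ℕ) : (1 / 2 : ℂ) + n ≠ 0 := fun h => by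
  have := congrArg Complex.re h
  simp at this
  have hn : (0 : ℝ) ≤ n := Nat.cast_nonneg n
  linarith

theorem toDisc_zero : toDisc 0 = 0 := by simp [toDisc]

/-- Near 0 the expansion in w applies and the two powers of 1 + w cancel; the identity theorem
extends the agreement to the whole unit disc in z. -/
theorem isGaussContinuation_discSum (a b : ℂ) : IsGaussContinuation a b (1 / 2)
    fun z => (1 + toDisc z) ^ (2 * a) * discSum a b (toDisc z) := by
  have hd : DifferentiableOn ℂ (fun z => (1 + toDisc z) ^ (2 * a) * discSum a b (toDisc z))
      cutPlane := by
    intro z hz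
    have h1 := differentiableAt_toDisc hz
    have h2 := norm_toDisc_lt_one hz
    exact (((h1.const_add 1).cpow_const (mem_slitPlane_of_norm_lt_one h2)).mul
      ((differentiableAt_discSum a b h2).comp z h1)).differentiableWithinAt
  refine ⟨hd, fun z hz => ?_⟩
  refine ((hd.mono ball_subset_cutPlane).analyticOnNhd
    Metric.isOpen_ball).eqOn_of_preconnected_of_eventuallyEq
    ((isSeriesOn_ordinaryHypergeometric a b (1 / 2)).differentiableOn.analyticOnNhd
      Metric.isOpen_ball) (convex_ball _ _).isPreconnected
      (Metric.mem_ball_self one_pos) ?_ (by simpa using hz)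
  have h0 : (0 : ℂ) ∈ cutPlane := ball_subset_cutPlane (Metric.mem_ball_self one_pos)
  have hc : ∀ᶠ z in 𝓝 (0 : ℂ), ‖toDisc z‖ < 1 / 8 := by
    have := (differentiableAt_toDisc h0).continuousAt.norm
    refine this.eventually_lt_const ?_
    simp [toDisc_zero]
  filter_upwards [hc, isOpen_cutPlane.mem_nhds h0] with z hz1 hz2
  have hs := (isSeriesOn_discCoeff a b (1 / 2) half_add_natCast_ne_zero (toDisc z) hz1).tsum_eq
  simp only [discMap_toDisc hz2] at hs
  have hne : 1 + toDisc z ≠ 0 :=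
    slitPlane_ne_zero (mem_slitPlane_of_norm_lt_one (norm_toDisc_lt_one hz2))
  rw [discSum, hs, ← mul_assoc, ← Complex.cpow_add _ _ hne,
    show 2 * a + -2 * a = 0 by ring, Complex.cpow_zero, one_mul]

theorem neg_three_mem_cutPlane : (-3 : ℂ) ∈ cutPlane := by
  intro x hx h
  have := congrArg Complex.re h
  simp at this
  linarith

theorem differentiable_gaussF {a b : ℂ → ℂ} (ha : Differentiable ℂ a) (hb : Differentiable ℂ b)
    {z : ℂ} (hz : z ∈ cutPlane) : Differentiable ℂ fun t => gaussF (a t) (b t) (1 / 2) z := by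
  simp only [(isGaussContinuation_discSum _ _).gaussF_eq hz]
  have hne : 1 + toDisc z ≠ 0 :=
    slitPlane_ne_zero (mem_slitPlane_of_norm_lt_one (norm_toDisc_lt_one hz))
  refine Differentiable.mul ?_ (differentiable_discSum ha hb (norm_toDisc_lt_one hz))
  exact fun t => ((ha t).const_mul 2).const_cpow (Or.inl hne)

/-! ### Triplication formula for Gamma -/

theorem prod_range_triple (s : ℂ) (n : ℕ) :
    3 ^ (3 * n) * ((∏ j ∈ Finset.range n, (s + j)) * (∏ j ∈ Finset.range n, (s + 1 / 3 + j)) *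
      ∏ j ∈ Finset.range n, (s + 2 / 3 + j)) = ∏ k ∈ Finset.range (3 * n), (3 * s + k) := by
  induction n with
  | zero => simp
  | succ n ih =>
    rw [show 3 * (n + 1) = 3 * n + 1 + 1 + 1 by ring]
    simp only [Finset.prod_range_succ]
    rw [← ih]
    push_cast
    ring

/-- The index 3n+2 makes the long product have exactly 3(n+1) factors, matching the three short
ones. The first factor on the right is free of s. -/
theorem GammaSeq_triple {s : ℂ} (hs : 0 < s.re) {n : ℕ} (hn : n ≠ 0) :
    GammaSeq s n * GammaSeq (s + 1 / 3) n * GammaSeq (s + 2 / 3) n =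
      (n * (n.factorial : ℂ) ^ 3 * 3 ^ (3 * (n + 1)) / ((3 * n + 2).factorial : ℂ)) *
        ((((n : ℝ) / (3 * n + 2) : ℝ) : ℂ) ^ (3 * s) * GammaSeq (3 * s) (3 * n + 2)) := by
  have hn0 : (n : ℂ) ≠ 0 := Nat.cast_ne_zero.2 hn
  have hprod : ∀ x : ℂ, 0 < x.re → ∀ m : ℕ, ∏ j ∈ Finset.range m, (x + j) ≠ 0 := by
    intro x hx m
    refine Finset.prod_ne_zero_iff.2 fun j _ h => ?_
    have := congrArg Complex.re h
    simp only [add_re, natCast_re, zero_re] at this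
    have hj : (0 : ℝ) ≤ j := Nat.cast_nonneg j
    linarith
  have h1 := hprod s hs (n + 1)
  have h2 := hprod (s + 1 / 3) (by simp; positivity) (n + 1)
  have h3 := hprod (s + 2 / 3) (by simp; positivity) (n + 1)
  have hfac : ((3 * n + 2).factorial : ℂ) ≠ 0 := Nat.cast_ne_zero.2 (Nat.factorial_ne_zero _)
  have hpow : (n : ℂ) ^ (3 * s) =
      (((n : ℝ) / (3 * n + 2) : ℝ) : ℂ) ^ (3 * s) * ((3 * n + 2 : ℕ) : ℂ) ^ (3 * s) := by
    rw [show ((3 * n + 2 : ℕ) : ℂ) = ((3 * n + 2 : ℝ) : ℂ) by push_cast; ring,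
      ← Complex.mul_cpow_ofReal_nonneg (by positivity) (by positivity)]
    congr 1
    rw [← Complex.ofReal_mul, div_mul_cancel₀ _ (by positivity), Complex.ofReal_natCast]
  have hsum : (n : ℂ) ^ s * (n : ℂ) ^ (s + 1 / 3) * (n : ℂ) ^ (s + 2 / 3) =
      n * (n : ℂ) ^ (3 * s) := by
    rw [← Complex.cpow_add _ _ hn0, ← Complex.cpow_add _ _ hn0,
      show s + (s + 1 / 3) + (s + 2 / 3) = 1 + 3 * s by ring, Complex.cpow_add _ _ hn0,
      Complex.cpow_one]
  have ht := prod_range_triple s (n + 1)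
  simp only [GammaSeq]
  rw [show 3 * n + 2 + 1 = 3 * (n + 1) by ring, ← ht]
  have h33 : (3 : ℂ) ^ (3 * (n + 1)) ≠ 0 := pow_ne_zero _ three_ne_zero
  generalize (∏ j ∈ Finset.range (n + 1), (s + j)) = p1 at *
  generalize (∏ j ∈ Finset.range (n + 1), (s + 1 / 3 + j)) = p2 at *
  generalize (∏ j ∈ Finset.range (n + 1), (s + 2 / 3 + j)) = p3 at *
  generalize (3 : ℂ) ^ (3 * (n + 1)) = q at *
  rw [hpow] at hsum
  generalize (((n : ℝ) / (3 * n + 2) : ℝ) : ℂ) ^ (3 * s) = x at *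
  generalize ((3 * n + 2 : ℕ) : ℂ) ^ (3 * s) = y at *
  generalize ((3 * n + 2).factorial : ℂ) = F at *
  generalize (n : ℂ) ^ s = a1 at *
  generalize (n : ℂ) ^ (s + 1 / 3) = a2 at *
  generalize (n : ℂ) ^ (s + 2 / 3) = a3 at *
  field_simp
  linear_combination (n.factorial : ℂ) ^ 3 * hsum

/-- The sequence does not involve s, so neither does its limit; the constant can be read off at any
one s. -/
theorem tendsto_GammaSeq_triple_const {s : ℂ} (hs : 0 < s.re) :
    Tendsto (fun n : ℕ => n * (n.factorial : ℂ) ^ 3 * 3 ^ (3 * (n + 1)) /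
      ((3 * n + 2).factorial : ℂ)) atTop
      (𝓝 (Gamma s * Gamma (s + 1 / 3) * Gamma (s + 2 / 3) /
        ((1 / 3 : ℂ) ^ (3 * s) * Gamma (3 * s)))) := by
  have h3s : 0 < (3 * s).re := by simpa using hs
  have hB : (1 / 3 : ℂ) ^ (3 * s) * Gamma (3 * s) ≠ 0 :=
    mul_ne_zero (by simp [Complex.cpow_eq_zero_iff]) (Complex.Gamma_ne_zero_of_re_pos h3s)
  have hA := ((GammaSeq_tendsto_Gamma s).mul (GammaSeq_tendsto_Gamma (s + 1 / 3))).mul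
    (GammaSeq_tendsto_Gamma (s + 2 / 3))
  have hsub : Tendsto (fun n : ℕ => 3 * n + 2) atTop atTop :=
    tendsto_atTop_mono (fun n => (by lia : n ≤ 3 * n + 2)) tendsto_id
  have hx : Tendsto (fun n : ℕ => (((n : ℝ) / (3 * n + 2) : ℝ) : ℂ)) atTop (𝓝 (1 / 3)) := by
    have := tendsto_add_mul_div_add_mul_atTop_nhds (0 : ℝ) 2 1 (d := 3) (by norm_num)
    have := (Complex.continuous_ofReal.tendsto _).comp this
    rw [show (((1 / 3 : ℝ)) : ℂ) = 1 / 3 by norm_num] at this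
    refine this.congr fun n => ?_
    simp [add_comm]
  have hx' : Tendsto (fun n : ℕ => (((n : ℝ) / (3 * n + 2) : ℝ) : ℂ) ^ (3 * s)) atTop
      (𝓝 ((1 / 3) ^ (3 * s))) :=
    hx.cpow tendsto_const_nhds (by simp [mem_slitPlane_iff])
  have hB' := hx'.mul ((GammaSeq_tendsto_Gamma (3 * s)).comp hsub)
  refine (hA.div hB' hB).congr' ?_
  filter_upwards [hB'.eventually_ne hB, eventually_ne_atTop 0] with n h1 h2
  simp only [Pi.div_apply, Function.comp_apply] at h1 ⊢
  rw [GammaSeq_triple hs h2, mul_div_cancel_right₀ _ h1]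

/-- The triplication formula for the Gamma function. -/
theorem Gamma_mul_Gamma_add_third_mul_Gamma_add_two_thirds {s : ℂ} (hs : 0 < s.re) :
    Gamma s * Gamma (s + 1 / 3) * Gamma (s + 2 / 3) =
      2 * Real.pi * Real.sqrt 3 * (1 / 3 : ℂ) ^ (3 * s) * Gamma (3 * s) := by
  have h3s : 0 < (3 * s).re := by simpa using hs
  have hB : (1 / 3 : ℂ) ^ (3 * s) * Gamma (3 * s) ≠ 0 :=
    mul_ne_zero (by simp [Complex.cpow_eq_zero_iff]) (Complex.Gamma_ne_zero_of_re_pos h3s)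
  -- At s = 1/3 the quotient reduces to Γ(1/3)Γ(2/3), which the reflection formula evaluates.
  have h := tendsto_nhds_unique (tendsto_GammaSeq_triple_const hs)
    (tendsto_GammaSeq_triple_const (s := 1 / 3) (by norm_num))
  have hrefl := Complex.Gamma_mul_Gamma_one_sub (1 / 3)
  have hsin : Complex.sin (Real.pi * (1 / 3)) = Real.sqrt 3 / 2 := by
    rw [show (Real.pi : ℂ) * (1 / 3) = ((Real.pi / 3 : ℝ) : ℂ) by push_cast; ring,
      ← Complex.ofReal_sin, Real.sin_pi_div_three]
    push_cast
    rfl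
  have h3 : ((Real.sqrt 3 : ℝ) : ℂ) ^ 2 = 3 := by
    rw [← Complex.ofReal_pow, Real.sq_sqrt (by norm_num)]
    norm_num
  have h30 : ((Real.sqrt 3 : ℝ) : ℂ) ≠ 0 := by
    intro h
    rw [h] at h3
    norm_num at h3
  rw [hsin, show (1 - 1 / 3 : ℂ) = 2 / 3 by norm_num] at hrefl
  norm_num at h
  rw [hrefl, div_eq_iff (by simpa using hB)] at h
  norm_num
  rw [h]
  field_simp
  linear_combination -Gamma (3 * s) * h3

/-! ### Cauchy's sine integral from a contour -/

theorem ofReal_mul_exp_mul_I_cpow {r α : ℝ} (hr : 0 < r) (h1 : -Real.pi < α) (h2 : α ≤ Real.pi)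
    (c : ℂ) : ((r : ℂ) * exp (α * I)) ^ c = (r : ℂ) ^ c * exp (α * I * c) := by
  have hr' : (r : ℂ) ≠ 0 := Complex.ofReal_ne_zero.2 hr.ne'
  rw [Complex.cpow_def_of_ne_zero (mul_ne_zero hr' (exp_ne_zero _)),
    Complex.cpow_def_of_ne_zero hr', Complex.log_ofReal_mul hr (exp_ne_zero _),
    Complex.log_exp (by simpa using h1) (by simpa using h2),
    Complex.ofReal_log hr.le, add_mul, Complex.exp_add]

theorem one_sub_mem_slitPlane_of_norm_lt_one {z : ℂ} (hz : ‖z‖ < 1) : 1 - z ∈ slitPlane := by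
  simpa [sub_eq_add_neg] using mem_slitPlane_of_norm_lt_one (z := -z) (by simpa using hz)

/-- The point z = 1 is included: the base vanishes there and Re c > 0 is what keeps the power
continuous. -/
theorem continuousAt_one_sub_cpow {c z : ℂ} (hc : 0 < c.re) (hz : ‖z‖ ≤ 1) :
    ContinuousAt (fun z : ℂ => (1 - z) ^ c) z := by
  have h : ContinuousAt (fun x : ℂ => x ^ c) (1 - z) := by
    refine Complex.continuousAt_cpow_const_of_re_pos (Or.inl ?_) hc
    have := (Complex.re_le_norm z).trans hz
    simpa using this
  exact ContinuousAt.comp (f := fun z : ℂ => 1 - z) h (by fun_prop)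

theorem Continuous.one_sub_cpow {X : Type*} [TopologicalSpace X] {g : X → ℂ} (hg : Continuous g)
    (h : ∀ x, ‖g x‖ ≤ 1) {c : ℂ} (hc : 0 < c.re) : Continuous fun x => (1 - g x) ^ c :=
  continuous_iff_continuousAt.2 fun x =>
    (continuousAt_one_sub_cpow hc (h x)).comp (f := g) hg.continuousAt

theorem continuous_one_sub_cube_cpow {c : ℂ} (hc : 0 < c.re) :
    Continuous fun s : ℝ => (1 - (s : ℂ) ^ 3) ^ c := by
  have := (Complex.continuous_ofReal_cpow_const hc).comp
    (by fun_prop : Continuous fun s : ℝ => 1 - s ^ 3)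
  refine this.congr fun s => ?_
  simp

/-- Integrating the primitive of `(1 - x ^ 3) ^ c` along an arc of the circle of radius `r < 1`. -/
theorem integral_arc_one_sub_cube_cpow_of_lt (c : ℂ) {r : ℝ} (hr0 : 0 ≤ r) (hr : r < 1) :
    ∫ θ in (0 : ℝ)..(Real.pi / 3),
      (1 - (r * exp (-2 * θ * I)) ^ 3) ^ c * (-2 * I * (r * exp (-2 * θ * I))) =
      (exp (-2 * (Real.pi / 3 : ℝ) * I) - 1) * ∫ s in (0 : ℝ)..r, (1 - (s : ℂ) ^ 3) ^ c := by
  have hsl : ∀ x : ℂ, ‖x‖ < 1 → 1 - x ^ 3 ∈ slitPlane := fun x hx =>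
    one_sub_mem_slitPlane_of_norm_lt_one (by
      rw [norm_pow]; exact pow_lt_one₀ (norm_nonneg _) hx three_ne_zero)
  have hdiff : DifferentiableOn ℂ (fun x : ℂ => (1 - x ^ 3) ^ c) (Metric.ball 0 1) := fun x hx =>
    ((by fun_prop : DifferentiableAt ℂ (fun x : ℂ => 1 - x ^ 3) x).cpow_const
      (hsl x (by simpa using hx))).differentiableWithinAt
  obtain ⟨P, hP⟩ := hdiff.isExactOn_ball
  -- On the ray through a cube root of unity, (sω)³ = s³, so the radial integrals differ only by the
  -- factor ω.
  have hray : ∀ ω : ℂ, ‖ω‖ = 1 → ω ^ 3 = 1 →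
      P (r * ω) - P 0 = ω * ∫ s in (0 : ℝ)..r, (1 - (s : ℂ) ^ 3) ^ c := by
    intro ω hω hω3
    have hmem : ∀ s ∈ Set.uIcc 0 r, ‖(s : ℂ)‖ < 1 := by
      intro s hs
      rw [Set.uIcc_of_le hr0] at hs
      rw [Complex.norm_real, Real.norm_of_nonneg hs.1]
      exact hs.2.trans_lt hr
    have hd : ∀ s ∈ Set.uIcc 0 r, HasDerivAt (fun s : ℝ => P (s * ω))
        (ω * (1 - (s : ℂ) ^ 3) ^ c) s := by
      intro s hs
      have h1 : HasDerivAt P ((1 - (s * ω) ^ 3) ^ c) ((s : ℂ) * ω) :=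
        hP _ (by simpa [hω] using hmem s hs)
      have h2 : HasDerivAt (fun s : ℂ => s * ω) ω (s : ℂ) := by
        simpa using (hasDerivAt_id (s : ℂ)).mul_const ω
      refine (HasDerivAt.comp (s : ℂ) h1 h2).comp_ofReal.congr_deriv ?_
      rw [mul_pow, hω3, mul_one, mul_comm]
    have hcont : ContinuousOn (fun s : ℝ => ω * (1 - (s : ℂ) ^ 3) ^ c) (Set.uIcc 0 r) := by
      refine continuousOn_const.mul fun s hs => ?_
      refine ContinuousAt.continuousWithinAt ?_
      refine ContinuousAt.cpow (by fun_prop) continuousAt_const (hsl _ (hmem s hs))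
    have := intervalIntegral.integral_eq_sub_of_hasDerivAt hd hcont.intervalIntegrable
    rw [intervalIntegral.integral_const_mul] at this
    simpa using this.symm
  have hnorm : ∀ θ : ℝ, ‖(r : ℂ) * exp (-2 * θ * I)‖ < 1 := by
    intro θ
    rw [show (-2 * (θ : ℂ) * I) = ((-2 * θ : ℝ) : ℂ) * I by push_cast; ring, norm_mul,
      Complex.norm_exp_ofReal_mul_I, mul_one, Complex.norm_real, Real.norm_of_nonneg hr0]
    exact hr
  have hd : ∀ θ ∈ Set.uIcc 0 (Real.pi / 3), HasDerivAt (fun θ : ℝ => P (r * exp (-2 * θ * I)))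
      ((1 - (r * exp (-2 * θ * I)) ^ 3) ^ c * (-2 * I * (r * exp (-2 * θ * I)))) θ := by
    intro θ _
    have h1 := hP _ (mem_ball_zero_iff.2 (hnorm θ))
    have h2 : HasDerivAt (fun θ : ℂ => (r : ℂ) * exp (-2 * θ * I))
        (-2 * I * (r * exp (-2 * θ * I))) (θ : ℂ) := by
      have := ((((hasDerivAt_id (θ : ℂ)).const_mul (-2)).mul_const I).cexp).const_mul (r : ℂ)
      refine this.congr_deriv ?_
      simp only [id]
      ring
    exact (HasDerivAt.comp (θ : ℂ) h1 h2).comp_ofReal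
  have hcont : Continuous fun θ : ℝ =>
      (1 - (r * exp (-2 * θ * I)) ^ 3) ^ c * (-2 * I * (r * exp (-2 * θ * I))) := by
    refine Continuous.mul ?_ (by fun_prop)
    exact Continuous.cpow (by fun_prop) continuous_const fun θ => hsl _ (hnorm θ)
  rw [intervalIntegral.integral_eq_sub_of_hasDerivAt hd (hcont.intervalIntegrable _ _)]
  have e1 := hray (exp (-2 * (Real.pi / 3 : ℝ) * I)) (by
    rw [show (-2 * ((Real.pi / 3 : ℝ) : ℂ) * I) = ((-2 * (Real.pi / 3) : ℝ) : ℂ) * I by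
      push_cast; ring, Complex.norm_exp_ofReal_mul_I]) (by
    rw [← Complex.exp_nat_mul, Complex.exp_eq_one_iff]
    exact ⟨-1, by push_cast; ring⟩)
  have e2 := hray 1 (by simp) (by simp)
  rw [mul_one] at e2
  simp only [Complex.ofReal_zero, mul_zero, zero_mul, Complex.exp_zero, mul_one]
  linear_combination e1 - e2

/-- Limit r → 1 of the previous identity. The parametrisation r = exp(-x²) stays in (0, 1] for every
real x, so both sides are continuous on all of ℝ and can be compared at x = 0. -/
theorem integral_arc_one_sub_cube_cpow {c : ℂ} (hc : 0 < c.re) :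
    ∫ θ in (0 : ℝ)..(Real.pi / 3),
      (1 - exp (-2 * θ * I) ^ 3) ^ c * (-2 * I * exp (-2 * θ * I)) =
      (exp (-2 * (Real.pi / 3 : ℝ) * I) - 1) * ∫ s in (0 : ℝ)..1, (1 - (s : ℂ) ^ 3) ^ c := by
  have hl : Continuous fun x : ℝ => ∫ θ in (0 : ℝ)..(Real.pi / 3),
      (1 - (Real.exp (-x ^ 2) * exp (-2 * θ * I)) ^ 3) ^ c *
        (-2 * I * (Real.exp (-x ^ 2) * exp (-2 * θ * I))) := by
    refine intervalIntegral.continuous_parametric_intervalIntegral_of_continuous' ?_ _ _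
    have hg : Continuous fun p : ℝ × ℝ => (Real.exp (-p.1 ^ 2) : ℂ) * exp (-2 * p.2 * I) := by
      fun_prop
    refine Continuous.mul (Continuous.one_sub_cpow (hg.pow 3) (fun p => ?_) hc)
      (continuous_const.mul hg)
    rw [Pi.pow_apply, norm_pow, norm_mul,
      show (-2 * (p.2 : ℂ) * I) = ((-2 * p.2 : ℝ) : ℂ) * I by push_cast; ring,
      Complex.norm_exp_ofReal_mul_I, mul_one, Complex.norm_real,
      Real.norm_of_nonneg (Real.exp_pos _).le]
    exact pow_le_one₀ (Real.exp_pos _).le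
      (Real.exp_le_one_iff.2 (neg_nonpos.2 (sq_nonneg p.1)))
  have hr : Continuous fun x : ℝ => (exp (-2 * (Real.pi / 3 : ℝ) * I) - 1) *
      ∫ s in (0 : ℝ)..Real.exp (-x ^ 2), (1 - (s : ℂ) ^ 3) ^ c := by
    refine continuous_const.mul ?_
    exact (intervalIntegral.continuous_primitive
      (fun a b => (continuous_one_sub_cube_cpow hc).intervalIntegrable a b) 0).comp
      (by fun_prop : Continuous fun x : ℝ => Real.exp (-x ^ 2))
  have heq := tendsto_nhds_unique_of_eventuallyEq ((hl.tendsto 0).mono_left nhdsWithin_le_nhds)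
    ((hr.tendsto 0).mono_left (nhdsWithin_le_nhds (s := {0}ᶜ))) (by
      filter_upwards [self_mem_nhdsWithin] with x hx
      have hx : x ≠ 0 := hx
      exact integral_arc_one_sub_cube_cpow_of_lt c (Real.exp_pos _).le
        (Real.exp_lt_one_iff.2 (by have := sq_pos_of_ne_zero hx; linarith)))
  simpa using heq

/-- Substitution x = s³ in the Beta integral. -/
theorem integral_one_sub_cube_cpow {c : ℂ} (hc : 0 < c.re) :
    ∫ s in (0 : ℝ)..1, (1 - (s : ℂ) ^ 3) ^ c = 1 / 3 * betaIntegral (1 / 3) (c + 1) := by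
  have hint := Complex.betaIntegral_convergent (u := 1 / 3) (v := c + 1) (by norm_num)
    (by simp; linarith)
  rw [intervalIntegrable_iff_integrableOn_Icc_of_le zero_le_one] at hint
  have himg : (fun s : ℝ => s ^ 3) '' Set.uIcc 0 1 ⊆ Set.Icc 0 1 := by
    rintro _ ⟨s, hs, rfl⟩
    rw [Set.uIcc_of_le zero_le_one] at hs
    exact ⟨pow_nonneg hs.1 3, pow_le_one₀ hs.1 hs.2⟩
  have hcomp : ∀ s : ℝ, 0 < s → (3 * s ^ 2) • (((s ^ 3 : ℝ) : ℂ) ^ ((1 / 3 : ℂ) - 1) *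
      (1 - ((s ^ 3 : ℝ) : ℂ)) ^ (c + 1 - 1)) = 3 * (1 - (s : ℂ) ^ 3) ^ c := by
    intro s hs
    have hs0 : (s : ℂ) ≠ 0 := Complex.ofReal_ne_zero.2 hs.ne'
    have h : ((s ^ 3 : ℝ) : ℂ) ^ ((1 / 3 : ℂ) - 1) = (s : ℂ) ^ (-2 : ℂ) := by
      rw [Complex.cpow_def_of_ne_zero (Complex.ofReal_ne_zero.2 (pow_pos hs 3).ne'),
        Complex.cpow_def_of_ne_zero hs0, ← Complex.ofReal_log hs.le,
        ← Complex.ofReal_log (pow_pos hs 3).le, Real.log_pow]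
      congr 1
      push_cast
      ring
    rw [h, show (-2 : ℂ) = ((-2 : ℤ) : ℂ) by norm_num, Complex.cpow_intCast, add_sub_cancel_right,
      Complex.real_smul, zpow_neg, zpow_ofNat]
    push_cast
    field_simp
  have hcont : Continuous fun s : ℝ => 3 * (1 - (s : ℂ) ^ 3) ^ c :=
    continuous_const.mul (continuous_one_sub_cube_cpow hc)
  -- The Beta integrand blows up at 0, so the form of the substitution rule needing continuity only
  -- in the open interval is used.
  have key := intervalIntegral.integral_deriv_smul_comp''' (a := 0) (b := 1)
    (f := fun s : ℝ => s ^ 3) (f' := fun s => 3 * s ^ 2)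
    (g := fun x : ℝ => (x : ℂ) ^ ((1 / 3 : ℂ) - 1) * (1 - (x : ℂ)) ^ (c + 1 - 1))
    (by fun_prop) (fun s _ => by simpa using (hasDerivAt_pow 3 s).hasDerivWithinAt) (by
      rintro _ ⟨s, hs, rfl⟩
      simp only [zero_le_one, inf_of_le_left, sup_of_le_right] at hs
      have h3 : 0 < s ^ 3 := pow_pos hs.1 3
      have h3' : s ^ 3 < 1 := pow_lt_one₀ hs.1.le hs.2 three_ne_zero
      refine ContinuousAt.continuousWithinAt (ContinuousAt.mul ?_ ?_)
      · exact ContinuousAt.cpow (by fun_prop) continuousAt_const (Or.inl (by rw [Complex.ofReal_re]; exact h3))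
      · refine ContinuousAt.cpow (by fun_prop) continuousAt_const (Or.inl ?_)
        rw [Complex.sub_re, Complex.one_re, Complex.ofReal_re]
        linarith)
    (hint.mono_set himg) (by
      rw [Set.uIcc_of_le zero_le_one, integrableOn_Icc_iff_integrableOn_Ioc]
      refine (hcont.integrableOn_Ioc).congr_fun (fun s hs => ?_) measurableSet_Ioc
      exact (hcomp s hs.1).symm)
  rw [betaIntegral]
  norm_num at key ⊢
  rw [← key, ← intervalIntegral.integral_const_mul]
  refine intervalIntegral.integral_congr_uIoo fun s hs => ?_
  have hs0 : 0 < s := by simpa using hs.1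
  have := hcomp s hs0
  norm_num at this ⊢
  rw [this]
  ring

theorem one_sub_exp_neg_two_mul_I (x : ℂ) :
    1 - exp (-2 * x * I) = 2 * sin x * I * exp (-x * I) := by
  have h1 : exp (x * I) * exp (-x * I) = 1 := by
    rw [← Complex.exp_add, show x * I + -x * I = 0 by ring, Complex.exp_zero]
  have h2 : exp (-2 * x * I) = exp (-x * I) * exp (-x * I) := by
    rw [← Complex.exp_add]
    ring_nf
  rw [Complex.sin, h2]
  linear_combination -h1 - (exp (-x * I) - exp (x * I)) * exp (-x * I) * I_sq

/-- The base is 2 sin 3θ times a unit of argument π/2 - 3θ, which lies in (-π/2, π/2), so the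
principal branch splits without correction. -/
theorem one_sub_exp_cube_cpow {θ : ℝ} (h0 : 0 < θ) (h1 : θ < Real.pi / 3) (c : ℂ) :
    (1 - exp (-2 * θ * I) ^ 3) ^ c =
      2 ^ c * (Real.sin (3 * θ) : ℂ) ^ c * exp ((Real.pi / 2 - 3 * θ) * I * c) := by
  have hsin : 0 < Real.sin (3 * θ) := Real.sin_pos_of_pos_of_lt_pi (by linarith) (by linarith)
  have h : 1 - exp (-2 * θ * I) ^ 3 =
      ((2 * Real.sin (3 * θ) : ℝ) : ℂ) * exp (((Real.pi / 2 - 3 * θ : ℝ) : ℂ) * I) := by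
    rw [← Complex.exp_nat_mul, show ((3 : ℕ) : ℂ) * (-2 * θ * I) = -2 * (3 * θ) * I by
      push_cast; ring, one_sub_exp_neg_two_mul_I]
    push_cast
    rw [sub_mul, sub_eq_add_neg, Complex.exp_add, Complex.exp_pi_div_two_mul_I]
    ring_nf
  rw [h, ofReal_mul_exp_mul_I_cpow (by positivity) (by linarith) (by linarith), Complex.ofReal_mul,
    Complex.mul_cpow_ofReal_nonneg (by norm_num) hsin.le]
  push_cast
  rfl

/-- The arc identity in polar form: (1 - e^(-6iθ))^c contributes the frequency -3c and dx the
frequency -2. -/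
theorem integral_sin_cpow_mul_exp_neg {c : ℂ} (hc : 0 < c.re) :
    2 ^ c * ∫ θ in (0 : ℝ)..(Real.pi / 3),
      (Real.sin (3 * θ) : ℂ) ^ c * exp (-((3 * c + 2) * θ * I)) =
      Real.sqrt 3 / 6 * betaIntegral (1 / 3) (c + 1) *
        exp (-((Real.pi / 3 + c * Real.pi / 2) * I)) := by
  have h := integral_arc_one_sub_cube_cpow hc
  rw [integral_one_sub_cube_cpow hc] at h
  have hint : ∫ θ in (0 : ℝ)..(Real.pi / 3),
      (1 - exp (-2 * θ * I) ^ 3) ^ c * (-2 * I * exp (-2 * θ * I)) =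
      (-2 * I * 2 ^ c * exp (c * Real.pi / 2 * I)) * ∫ θ in (0 : ℝ)..(Real.pi / 3),
      (Real.sin (3 * θ) : ℂ) ^ c * exp (-((3 * c + 2) * θ * I)) := by
    rw [← intervalIntegral.integral_const_mul]
    refine intervalIntegral.integral_congr_uIoo fun θ hθ => ?_
    rw [Set.uIoo_of_le (by positivity)] at hθ
    rw [one_sub_exp_cube_cpow hθ.1 hθ.2]
    have e : exp ((Real.pi / 2 - 3 * θ) * I * c) * exp (-2 * θ * I) =
        exp (c * Real.pi / 2 * I) * exp (-((3 * c + 2) * θ * I)) := by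
      rw [← Complex.exp_add, ← Complex.exp_add]
      ring_nf
    linear_combination (2 ^ c * (Real.sin (3 * θ) : ℂ) ^ c * (-2 * I)) * e
  rw [hint] at h
  have hω := one_sub_exp_neg_two_mul_I ((Real.pi / 3 : ℝ) : ℂ)
  rw [← Complex.ofReal_sin, Real.sin_pi_div_three] at hω
  have e1 : exp (-((Real.pi / 3 + c * Real.pi / 2) * I)) * exp (c * Real.pi / 2 * I) =
      exp (-((Real.pi / 3 : ℝ) : ℂ) * I) := by
    rw [← Complex.exp_add]
    push_cast
    ring_nf
  have hne : (-2 * I * exp (c * Real.pi / 2 * I)) ≠ 0 :=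
    mul_ne_zero (mul_ne_zero (by norm_num) I_ne_zero) (exp_ne_zero _)
  refine mul_left_cancel₀ hne ?_
  rw [← e1] at hω
  push_cast at hω h ⊢
  linear_combination h - (1 / 3 * betaIntegral (1 / 3) (c + 1)) * hω

/-- Reflection θ ↦ π/3 - θ, which preserves sin 3θ. -/
theorem integral_sin_cpow_mul_exp {c : ℂ} :
    ∫ θ in (0 : ℝ)..(Real.pi / 3), (Real.sin (3 * θ) : ℂ) ^ c * exp ((3 * c + 2) * θ * I) =
      exp ((3 * c + 2) * (Real.pi / 3) * I) * ∫ θ in (0 : ℝ)..(Real.pi / 3),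
        (Real.sin (3 * θ) : ℂ) ^ c * exp (-((3 * c + 2) * θ * I)) := by
  have h := intervalIntegral.integral_comp_sub_left (a := 0) (b := Real.pi / 3)
    (fun θ : ℝ => (Real.sin (3 * θ) : ℂ) ^ c * exp ((3 * c + 2) * θ * I)) (Real.pi / 3)
  rw [sub_self, sub_zero] at h
  rw [← h, ← intervalIntegral.integral_const_mul]
  refine intervalIntegral.integral_congr fun θ _ => ?_
  rw [show 3 * (Real.pi / 3 - θ) = Real.pi - 3 * θ by ring, Real.sin_pi_sub, mul_left_comm,
    ← Complex.exp_add]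
  push_cast
  ring_nf

/-- A case of Cauchy's formula for `∫ sin ^ c φ cos (a φ) dφ` over `[0, π]`. -/
theorem integral_sin_cpow_mul_exp_add_exp {c : ℂ} (hc : 0 < c.re) :
    2 ^ c * ∫ θ in (0 : ℝ)..(Real.pi / 3), (Real.sin (3 * θ) : ℂ) ^ c *
      (exp ((3 * c + 2) * θ * I) + exp (-((3 * c + 2) * θ * I))) =
      Real.sqrt 3 / 3 * betaIntegral (1 / 3) (c + 1) * cos (Real.pi / 3 + c * Real.pi / 2) := by
  have hcont : Continuous fun θ : ℝ => (Real.sin (3 * θ) : ℂ) ^ c :=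
    (Complex.continuous_ofReal_cpow_const hc).comp
      (by fun_prop : Continuous fun θ : ℝ => Real.sin (3 * θ))
  simp only [mul_add]
  rw [intervalIntegral.integral_add
    (f := fun θ : ℝ => (Real.sin (3 * θ) : ℂ) ^ c * exp ((3 * c + 2) * θ * I))
    (g := fun θ : ℝ => (Real.sin (3 * θ) : ℂ) ^ c * exp (-((3 * c + 2) * θ * I)))
    ((hcont.mul (by fun_prop)).intervalIntegrable _ _)
    ((hcont.mul (by fun_prop)).intervalIntegrable _ _),
    integral_sin_cpow_mul_exp, mul_add, mul_left_comm, integral_sin_cpow_mul_exp_neg hc,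
    Complex.cos]
  have e : exp ((3 * c + 2) * (Real.pi / 3) * I) *
      exp (-((Real.pi / 3 + c * Real.pi / 2) * I)) =
      exp ((Real.pi / 3 + c * Real.pi / 2) * I) := by
    rw [← Complex.exp_add]
    ring_nf
  rw [← neg_mul] at e ⊢
  linear_combination (Real.sqrt 3 / 6 * betaIntegral (1 / 3) (c + 1)) * e

/-! ### Integral representation of the hypergeometric function -/

theorem betaIntegral_add_one_left {u v : ℂ} (hu : 0 < u.re) (hv : 0 < v.re) :
    (u + v) * betaIntegral (u + 1) v = u * betaIntegral u v := by
  have huv : 0 < (u + v).re := by simpa using add_pos hu hv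
  have h1 := Complex.Gamma_mul_Gamma_eq_betaIntegral hu hv
  have h2 := Complex.Gamma_mul_Gamma_eq_betaIntegral (s := u + 1) (t := v)
    (by simp; linarith) hv
  have hu0 : u ≠ 0 := fun h => by simp [h] at hu
  have huv0 : u + v ≠ 0 := fun h => by simp [h] at huv
  rw [Complex.Gamma_add_one _ hu0, show u + 1 + v = u + v + 1 by ring,
    Complex.Gamma_add_one _ huv0] at h2
  refine mul_left_cancel₀ (Complex.Gamma_ne_zero_of_re_pos huv) ?_
  linear_combination -h2 + u * h1

theorem ascPochhammer_eval_ne_zero {x : ℂ} (hx : 0 < x.re) (n : ℕ) :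
    (ascPochhammer ℂ n).eval x ≠ 0 := by
  rw [Ne, ascPochhammer_eval_eq_zero_iff]
  rintro ⟨k, _, hk⟩
  have := congrArg Complex.re hk
  simp only [natCast_re, neg_re] at this
  have hk0 : (0 : ℝ) ≤ k := Nat.cast_nonneg k
  linarith

theorem betaIntegral_add_natCast_left {u v : ℂ} (hu : 0 < u.re) (hv : 0 < v.re) (n : ℕ) :
    (ascPochhammer ℂ n).eval (u + v) * betaIntegral (u + n) v =
      (ascPochhammer ℂ n).eval u * betaIntegral u v := by
  induction n with
  | zero => simp
  | succ n ih =>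
    have h := betaIntegral_add_one_left (u := u + n) (v := v)
      (by simp only [add_re, natCast_re]; positivity) hv
    rw [ascPochhammer_succ_eval, ascPochhammer_succ_eval]
    push_cast
    rw [← add_assoc]
    linear_combination (ascPochhammer ℂ n).eval (u + v) * h + (u + n) * ih

theorem isSeriesOn_one_sub_cpow_neg (a : ℂ) :
    IsSeriesOn (fun n => (ascPochhammer ℂ n).eval a / n.factorial) (fun x => (1 - x) ^ (-a)) 1 := by
  intro z hz
  have h := (Complex.one_div_one_sub_cpow_hasFPowerSeriesOnBall_zero a).hasSum (y := z) (by
    rw [← ENNReal.ofReal_one, Metric.eball_ofReal]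
    simpa using hz)
  simp only [FormalMultilinearSeries.ofScalars_apply_eq, zero_add, smul_eq_mul, one_div,
    ← Complex.cpow_neg] at h
  refine HasSum.congr_fun h fun n => ?_
  congr 1
  rw [div_eq_iff (Nat.cast_ne_zero.2 (Nat.factorial_ne_zero n)), ← Ring.multichoose_eq,
    mul_comm, ← nsmul_eq_mul, Ring.factorial_nsmul_multichoose_eq_ascPochhammer,
    Polynomial.ascPochhammer_smeval_eq_eval]

theorem ascPochhammer_eval_two_mul (a : ℂ) (n : ℕ) :
    (ascPochhammer ℂ (2 * n)).eval (2 * a) / ((2 * n).factorial : ℂ) =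
      ordinaryHypergeometricCoefficient a (a + 1 / 2) (1 / 2) n := by
  induction n with
  | zero => simp [ordinaryHypergeometricCoefficient]
  | succ n ih =>
    have h := ordinaryHypergeometricCoefficient_succ a (a + 1 / 2) (1 / 2) n
      (half_add_natCast_ne_zero n)
    have hn : (n : ℂ) + 1 ≠ 0 := Nat.cast_add_one_ne_zero n
    have hn' := half_add_natCast_ne_zero n
    refine mul_left_cancel₀ (mul_ne_zero hn hn') ?_
    rw [h, ← ih, show 2 * (n + 1) = 2 * n + 1 + 1 by ring, ascPochhammer_succ_eval,
      ascPochhammer_succ_eval, Nat.factorial_succ, Nat.factorial_succ]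
    have h1 : ((2 * n).factorial : ℂ) ≠ 0 := Nat.cast_ne_zero.2 (Nat.factorial_ne_zero _)
    have h2 : (2 * (n : ℂ) + 1 + 1) ≠ 0 := by exact_mod_cast Nat.succ_ne_zero (2 * n + 1)
    have h3 : (2 * (n : ℂ) + 1) ≠ 0 := by exact_mod_cast Nat.succ_ne_zero (2 * n)
    generalize (ascPochhammer ℂ (2 * n)).eval (2 * a) = p
    push_cast
    generalize (n : ℂ) = x at *
    rw [show (x + 1) * (1 / 2 + x) = (2 * x + 1 + 1) * (2 * x + 1) / 4 by ring]
    field_simp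
    ring

/-- Odd terms of the two binomial series cancel, and the even ones are hypergeometric coefficients
by splitting (2a)_(2n) and (2n)! into even and odd factors. -/
theorem hasSum_one_add_cpow_add_one_sub_cpow (a : ℂ) {x : ℂ} (hx : ‖x‖ < 1) :
    HasSum (fun n => 2 * ordinaryHypergeometricCoefficient a (a + 1 / 2) (1 / 2) n * (x ^ 2) ^ n)
      ((1 + x) ^ (-(2 * a)) + (1 - x) ^ (-(2 * a))) := by
  have h := (isSeriesOn_one_sub_cpow_neg (2 * a) (-x) (by simpa using hx)).add
    (isSeriesOn_one_sub_cpow_neg (2 * a) x hx)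
  simp only [sub_neg_eq_add] at h
  rw [← (mul_right_injective₀ (two_ne_zero' ℕ)).hasSum_iff] at h
  · refine HasSum.congr_fun h fun n => ?_
    simp only [Function.comp_apply]
    rw [← ascPochhammer_eval_two_mul, neg_pow, pow_mul (-1 : ℂ), neg_one_sq, one_pow, pow_mul x]
    ring
  · intro n hn
    have hodd : Odd n := by
      rw [← Nat.not_even_iff_odd]
      rintro ⟨k, hk⟩
      exact hn ⟨k, by simp only; lia⟩
    rw [hodd.neg_pow]
    ring

theorem integral_cpow_mul_pow {b c : ℂ} (hb : 1 < b.re) (hc : 0 < c.re) (n : ℕ) :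
    (ascPochhammer ℂ n).eval (b + (c + 1)) *
      ∫ u in (0 : ℝ)..1, (u : ℂ) ^ (b - 1) * (1 - u : ℂ) ^ c * (u : ℂ) ^ n =
      (ascPochhammer ℂ n).eval b * betaIntegral b (c + 1) := by
  rw [← betaIntegral_add_natCast_left (by linarith) (by simp; linarith), betaIntegral]
  congr 1
  refine intervalIntegral.integral_congr_uIoo fun u hu => ?_
  rw [Set.uIoo_of_le zero_le_one] at hu
  rw [show b + n - 1 = b - 1 + n by ring,
    Complex.cpow_add _ _ (Complex.ofReal_ne_zero.2 hu.1.ne'), Complex.cpow_natCast,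
    add_sub_cancel_right]
  ring

theorem continuous_beta_weight {b c : ℂ} (hb : 1 < b.re) (hc : 0 < c.re) :
    Continuous fun u : ℝ => (u : ℂ) ^ (b - 1) * (1 - u : ℂ) ^ c := by
  refine (Complex.continuous_ofReal_cpow_const (by simp; linarith)).mul ?_
  have := (Complex.continuous_ofReal_cpow_const hc).comp
    (by fun_prop : Continuous fun s : ℝ => 1 - s)
  refine this.congr fun s => ?_
  simp

theorem integral_one_add_cpow_eq_of_norm_lt_one {a b c : ℂ} (hb : 1 < b.re) (hc : 0 < c.re)
    (habc : b + (c + 1) = a + 1 / 2) {y : ℂ} (hy : ‖y‖ < 1) :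
    ∫ u in (0 : ℝ)..1, (u : ℂ) ^ (b - 1) * (1 - u : ℂ) ^ c *
      ((1 + y * I * Real.sqrt u) ^ (-(2 * a)) + (1 - y * I * Real.sqrt u) ^ (-(2 * a))) =
      2 * betaIntegral b (c + 1) * ₂F₁ a b (1 / 2) (-y ^ 2) := by
  set k : ℝ → ℂ := fun u => (u : ℂ) ^ (b - 1) * (1 - u : ℂ) ^ c with hk
  have hkc : Continuous k := continuous_beta_weight hb hc
  obtain ⟨C, hC⟩ := isCompact_Icc.exists_bound_of_continuousOn (s := Set.Icc (0 : ℝ) 1)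
    hkc.continuousOn
  set A := ordinaryHypergeometricCoefficient a (a + 1 / 2) (1 / 2) with hA
  have hy2 : ‖y ^ 2‖ < 1 := by
    rw [norm_pow]
    exact pow_lt_one₀ (norm_nonneg _) hy two_ne_zero
  have hsq : ∀ u ∈ Set.Icc (0 : ℝ) 1, (y * I * Real.sqrt u) ^ 2 = -y ^ 2 * u := by
    intro u hu
    rw [mul_pow, mul_pow, I_sq, ← Complex.ofReal_pow, Real.sq_sqrt hu.1]
    ring
  have hsum := intervalIntegral.hasSum_integral_of_dominated_convergence (μ := MeasureTheory.volume)
    (a := 0) (b := 1) (F := fun n u => k u * (2 * A n * (-y ^ 2 * u) ^ n))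
    (f := fun u : ℝ => k u * ((1 + y * I * Real.sqrt u) ^ (-(2 * a)) +
      (1 - y * I * Real.sqrt u) ^ (-(2 * a))))
    (fun n _ => C * (2 * ‖A n * (y ^ 2) ^ n‖))
    (fun n => (hkc.mul (by fun_prop)).aestronglyMeasurable)
    (fun n => Eventually.of_forall fun u hu => by
      rw [Set.uIoc_of_le zero_le_one] at hu
      have hu1 : ‖(u : ℂ)‖ ≤ 1 := by
        rw [Complex.norm_real, Real.norm_of_nonneg hu.1.le]
        exact hu.2
      have hC0 : 0 ≤ C := (norm_nonneg _).trans (hC u ⟨hu.1.le, hu.2⟩)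
      rw [norm_mul]
      refine mul_le_mul (hC u ⟨hu.1.le, hu.2⟩) ?_ (norm_nonneg _) hC0
      rw [mul_assoc, norm_mul (2 : ℂ), norm_mul (A n), norm_mul (A n), Complex.norm_ofNat,
        norm_pow, norm_mul (-y ^ 2), norm_neg, norm_pow (y ^ 2)]
      gcongr
      exact mul_le_of_le_one_right (norm_nonneg _) hu1)
    (Eventually.of_forall fun u _ => (((isSeriesOn_ordinaryHypergeometric a (a + 1 / 2)
      (1 / 2)) _ hy2).summable.norm.mul_left 2).mul_left C)
    intervalIntegrable_const
    (Eventually.of_forall fun u hu => by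
      rw [Set.uIoc_of_le zero_le_one] at hu
      rw [← hsq u ⟨hu.1.le, hu.2⟩]
      refine (hasSum_one_add_cpow_add_one_sub_cpow a ?_).mul_left _
      rw [norm_mul, norm_mul, norm_I, mul_one, Complex.norm_real,
        Real.norm_of_nonneg (Real.sqrt_nonneg _)]
      exact (mul_le_of_le_one_right (norm_nonneg _) (Real.sqrt_le_one.2 hu.2)).trans_lt hy)
  refine hsum.unique ?_
  have hF := (isSeriesOn_ordinaryHypergeometric a b (1 / 2) (-y ^ 2) (by simpa using hy2)).mul_left
    (2 * betaIntegral b (c + 1))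
  refine HasSum.congr_fun hF fun n => ?_
  have hint := integral_cpow_mul_pow hb hc n
  have hne : (ascPochhammer ℂ n).eval (a + 1 / 2) ≠ 0 := by
    rw [← habc]
    refine ascPochhammer_eval_ne_zero ?_ n
    simp only [add_re, one_re]
    linarith
  have e : ∀ u : ℝ, k u * (2 * A n * (-y ^ 2 * u) ^ n) =
      (2 * A n * (-y ^ 2) ^ n) * (k u * (u : ℂ) ^ n) := fun u => by
    rw [mul_pow]
    ring
  simp only [e]
  rw [intervalIntegral.integral_const_mul]
  -- Here the factor (b+c+1)_n of the moment identity becomes the (a+1/2)_n occurring in `A n`.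
  rw [habc] at hint
  simp only [hA, ordinaryHypergeometricCoefficient, hk]
  linear_combination (2 * (n.factorial : ℂ)⁻¹ * (ascPochhammer ℂ n).eval a *
    ((ascPochhammer ℂ n).eval (1 / 2))⁻¹ * (-y ^ 2) ^ n) * hint

theorem one_add_mul_I_sqrt_mem_slitPlane {y : ℂ} (hy : |y.im| < 1) {u : ℝ}
    (hu : u ∈ Set.Icc (0 : ℝ) 1) : 1 + y * I * Real.sqrt u ∈ slitPlane := by
  refine Or.inl ?_
  have h1 : (1 + y * I * (Real.sqrt u : ℂ)).re = 1 - y.im * Real.sqrt u := by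
    simp
    ring
  rw [h1]
  have h2 := Real.sqrt_nonneg u
  have h3 := Real.sqrt_le_one.2 hu.2
  have h4 := mul_le_mul (le_abs_self y.im) h3 h2 (abs_nonneg _)
  linarith

theorem isOpen_abs_im_lt_one : IsOpen {y : ℂ | |y.im| < 1} :=
  isOpen_lt (by fun_prop) continuous_const

theorem differentiableOn_integral_one_add_cpow {k : ℝ → ℂ} (hk : Continuous k) (s : ℂ) :
    DifferentiableOn ℂ (fun y => ∫ u in (0 : ℝ)..1, k u * (1 + y * I * Real.sqrt u) ^ s)
      {y : ℂ | |y.im| < 1} := by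
  intro y₀ hy₀
  -- A closed ball inside the strip is compact, so the derivative of the integrand in y is bounded
  -- on it uniformly in u.
  obtain ⟨ε, hε, hball⟩ := Metric.nhds_basis_closedBall.mem_iff.1
    (isOpen_abs_im_lt_one.mem_nhds hy₀)
  set F' : ℂ → ℝ → ℂ := fun y u =>
    k u * (s * (1 + y * I * Real.sqrt u) ^ (s - 1) * (I * Real.sqrt u)) with hF'
  have hF'c : ContinuousOn (Function.uncurry F')
      (Metric.closedBall y₀ ε ×ˢ Set.Icc (0 : ℝ) 1) := by
    rintro ⟨y, u⟩ ⟨hy, hu⟩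
    refine ContinuousAt.continuousWithinAt ?_
    refine ContinuousAt.mul (hk.continuousAt.comp (by fun_prop)) (ContinuousAt.mul
      (continuousAt_const.mul (ContinuousAt.cpow (by fun_prop) continuousAt_const ?_))
      (by fun_prop))
    exact one_add_mul_I_sqrt_mem_slitPlane (hball hy) hu
  obtain ⟨C, hC⟩ := ((isCompact_closedBall y₀ ε).prod
    isCompact_Icc).exists_bound_of_continuousOn hF'c
  have hFc : ∀ (r y : ℂ), |y.im| < 1 →
      ContinuousOn (fun u : ℝ => (1 + y * I * Real.sqrt u) ^ r) (Set.Icc 0 1) := by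
    intro r y hy u hu
    exact ContinuousAt.continuousWithinAt (ContinuousAt.cpow (by fun_prop) continuousAt_const
      (one_add_mul_I_sqrt_mem_slitPlane hy hu))
  have hFc' : ∀ y : ℂ, |y.im| < 1 →
      ContinuousOn (fun u : ℝ => k u * (1 + y * I * Real.sqrt u) ^ s) (Set.Icc 0 1) :=
    fun y hy => hk.continuousOn.mul (hFc s y hy)
  have hmeas : ∀ g : ℝ → ℂ, ContinuousOn g (Set.Icc 0 1) → MeasureTheory.AEStronglyMeasurable g
      (MeasureTheory.volume.restrict (Set.uIoc (0 : ℝ) 1)) := by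
    intro g hg
    rw [Set.uIoc_of_le zero_le_one]
    exact (hg.mono Set.Ioc_subset_Icc_self).aestronglyMeasurable measurableSet_Ioc
  have key := intervalIntegral.hasDerivAt_integral_of_dominated_loc_of_deriv_le
    (μ := MeasureTheory.volume) (a := 0) (b := 1)
    (F := fun y u => k u * (1 + y * I * Real.sqrt u) ^ s) (F' := F') (bound := fun _ => C)
    (Metric.ball_mem_nhds y₀ hε)
    (by
      filter_upwards [Metric.ball_mem_nhds y₀ hε] with y hy
      exact hmeas _ (hFc' y (hball (Metric.ball_subset_closedBall hy))))
    (by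
      refine ContinuousOn.intervalIntegrable ?_
      rw [Set.uIcc_of_le zero_le_one]
      exact hFc' y₀ hy₀)
    (hmeas _ (hk.continuousOn.mul ((continuousOn_const.mul (hFc (s - 1) y₀ hy₀)).mul
      (by fun_prop))))
    (Eventually.of_forall fun u hu y hy => by
      rw [Set.uIoc_of_le zero_le_one] at hu
      exact hC (y, u) ⟨Metric.ball_subset_closedBall hy, Set.Ioc_subset_Icc_self hu⟩)
    intervalIntegrable_const
    (Eventually.of_forall fun u hu y hy => by
      rw [Set.uIoc_of_le zero_le_one] at hu
      have hsl := one_add_mul_I_sqrt_mem_slitPlane (hball (Metric.ball_subset_closedBall hy))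
        (Set.Ioc_subset_Icc_self hu)
      have h1 : HasDerivAt (fun y : ℂ => 1 + y * I * (Real.sqrt u : ℂ)) (I * Real.sqrt u) y := by
        have := (((hasDerivAt_id y).mul_const I).mul_const (Real.sqrt u : ℂ)).const_add 1
        simpa using this
      exact (h1.cpow_const hsl).const_mul (k u))
  exact key.2.differentiableAt.differentiableWithinAt

theorem neg_sq_mem_cutPlane {y : ℂ} (hy : |y.im| < 1) : -y ^ 2 ∈ cutPlane := by
  intro x hx h
  have hre := congrArg Complex.re h
  have him := congrArg Complex.im h
  simp only [neg_re, neg_im, sq, mul_re, mul_im, ofReal_re, ofReal_im] at hre him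
  have hy2 : y.im ^ 2 < 1 := by
    rw [← sq_abs]
    exact pow_lt_one₀ (abs_nonneg _) hy two_ne_zero
  nlinarith [sq_nonneg y.re]

/-- The series argument needs |y| < 1, but both sides are holomorphic in the strip |Im y| < 1, which
contains y = √3. -/
theorem integral_one_add_cpow_eq {a b c : ℂ} (hb : 1 < b.re) (hc : 0 < c.re)
    (habc : b + (c + 1) = a + 1 / 2) {y : ℂ} (hy : |y.im| < 1) :
    ∫ u in (0 : ℝ)..1, (u : ℂ) ^ (b - 1) * (1 - u : ℂ) ^ c *
      ((1 + y * I * Real.sqrt u) ^ (-(2 * a)) + (1 - y * I * Real.sqrt u) ^ (-(2 * a))) =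
      2 * betaIntegral b (c + 1) * gaussF a b (1 / 2) (-y ^ 2) := by
  have hkc := continuous_beta_weight hb hc
  have hd := differentiableOn_integral_one_add_cpow hkc (-(2 * a))
  have hd' := hd.comp (f := fun y : ℂ => -y) (s := {y : ℂ | |y.im| < 1})
    (differentiable_neg.differentiableOn) (fun y (hy : |y.im| < 1) => by simpa using hy)
  have hint : ∀ y : ℂ, |y.im| < 1 → IntervalIntegrable (fun u : ℝ =>
      (u : ℂ) ^ (b - 1) * (1 - u : ℂ) ^ c * (1 + y * I * Real.sqrt u) ^ (-(2 * a)))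
      MeasureTheory.volume 0 1 := by
    intro y hy
    refine ContinuousOn.intervalIntegrable ?_
    rw [Set.uIcc_of_le zero_le_one]
    refine hkc.continuousOn.mul fun u hu => ?_
    exact ContinuousAt.continuousWithinAt (ContinuousAt.cpow (by fun_prop) continuousAt_const
      (one_add_mul_I_sqrt_mem_slitPlane hy hu))
  have hJ : DifferentiableOn ℂ (fun y : ℂ => ∫ u in (0 : ℝ)..1, (u : ℂ) ^ (b - 1) *
      (1 - u : ℂ) ^ c * ((1 + y * I * Real.sqrt u) ^ (-(2 * a)) +
      (1 - y * I * Real.sqrt u) ^ (-(2 * a)))) {y : ℂ | |y.im| < 1} := by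
    refine (hd.add hd').congr fun y hy => ?_
    simp only [mul_add, Pi.add_apply, Function.comp_apply]
    have h2 := hint (-y) (by simpa using hy)
    rw [← intervalIntegral.integral_add (hint y hy) h2]
    refine intervalIntegral.integral_congr fun u _ => ?_
    simp only [neg_mul, ← sub_eq_add_neg]
  have hG : DifferentiableOn ℂ (fun y : ℂ => 2 * betaIntegral b (c + 1) *
      gaussF a b (1 / 2) (-y ^ 2)) {y : ℂ | |y.im| < 1} := by
    have hGc := isGaussContinuation_discSum a b
    refine ((hGc.1.comp (f := fun y : ℂ => -y ^ 2) (by fun_prop)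
      (fun y hy => neg_sq_mem_cutPlane hy)).const_mul (2 * betaIntegral b (c + 1))).congr
      fun y hy => ?_
    simp only [Function.comp_apply]
    rw [hGc.gaussF_eq (neg_sq_mem_cutPlane hy)]
  have hconv : IsPreconnected {y : ℂ | |y.im| < 1} := by
    have : {y : ℂ | |y.im| < 1} = Complex.imLm ⁻¹' Set.Ioo (-1) 1 := by
      ext y
      simp [abs_lt]
    rw [this]
    exact ((convex_Ioo (-1 : ℝ) 1).linear_preimage Complex.imLm).isPreconnected
  refine (hJ.analyticOnNhd isOpen_abs_im_lt_one).eqOn_of_preconnected_of_eventuallyEq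
    (hG.analyticOnNhd isOpen_abs_im_lt_one) hconv (z₀ := 0) (by simp) ?_ hy
  filter_upwards [Metric.ball_mem_nhds (0 : ℂ) one_pos] with y hy
  have hy1 : ‖y‖ < 1 := by simpa using hy
  have hy2 : ‖-y ^ 2‖ < 1 := by
    rw [norm_neg, norm_pow]
    exact pow_lt_one₀ (norm_nonneg _) hy1 two_ne_zero
  obtain ⟨G, hGc⟩ : ∃ G, IsGaussContinuation a b (1 / 2) G := ⟨_, isGaussContinuation_discSum a b⟩
  rw [integral_one_add_cpow_eq_of_norm_lt_one hb hc habc hy1,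
    hGc.gaussF_eq (ball_subset_cutPlane (by simpa using hy2)), hGc.2 _ hy2]

/-! ### The substitution u = tan²θ/3 at y = √3 -/

theorem sin_three_mul_eq_cos_cube_mul {θ : ℝ} (h : Real.cos θ ≠ 0) :
    Real.sin (3 * θ) = Real.cos θ ^ 3 * (Real.tan θ * (3 - Real.tan θ ^ 2)) := by
  rw [Real.sin_three_mul, Real.tan_eq_sin_div_cos]
  field_simp
  linear_combination (-3 * Real.sin θ) * Real.sin_sq_add_cos_sq θ

theorem one_add_tan_mul_I_cpow {θ : ℝ} (h1 : -(Real.pi / 2) < θ) (h2 : θ < Real.pi / 2) (s : ℂ) :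
    (1 + Real.tan θ * I) ^ (-s) = (Real.cos θ : ℂ) ^ s * exp (-(s * θ * I)) := by
  have hcos : 0 < Real.cos θ := Real.cos_pos_of_mem_Ioo ⟨h1, h2⟩
  have hc0 : (Real.cos θ : ℂ) ≠ 0 := Complex.ofReal_ne_zero.2 hcos.ne'
  have h : 1 + Real.tan θ * I = (((Real.cos θ)⁻¹ : ℝ) : ℂ) * exp (θ * I) := by
    rw [Complex.exp_mul_I, ← Complex.ofReal_cos, ← Complex.ofReal_sin, Real.tan_eq_sin_div_cos]
    push_cast at hc0 ⊢
    field_simp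
  rw [h, ofReal_mul_exp_mul_I_cpow (by positivity) (by linarith [Real.pi_pos])
    (by linarith [Real.pi_pos]), Complex.ofReal_inv, Complex.cpow_neg, Complex.inv_cpow, inv_inv]
  · ring_nf
  · rw [Complex.arg_ofReal_of_nonneg hcos.le]
    exact Real.pi_pos.ne

theorem integrand_tan_substitution {θ : ℝ} (h0 : 0 < θ) (h1 : θ < Real.pi / 3) (t : ℂ) :
    (2 / 3 * Real.tan θ / Real.cos θ ^ 2 : ℝ) •
      (((Real.tan θ ^ 2 / 3 : ℝ) : ℂ) ^ (t + 1 / 6 - 1) *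
        (1 - ((Real.tan θ ^ 2 / 3 : ℝ) : ℂ)) ^ (2 * t - 2 / 3) *
      ((1 + (Real.sqrt 3 : ℂ) * I * Real.sqrt (Real.tan θ ^ 2 / 3)) ^ (-(2 * (3 * t))) +
        (1 - (Real.sqrt 3 : ℂ) * I * Real.sqrt (Real.tan θ ^ 2 / 3)) ^ (-(2 * (3 * t))))) =
      2 / 3 * (3 : ℂ) ^ (3 / 2 - 3 * t) * ((Real.sin (3 * θ) : ℂ) ^ (2 * t - 2 / 3) *
        (exp ((3 * (2 * t - 2 / 3) + 2) * θ * I) +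
          exp (-((3 * (2 * t - 2 / 3) + 2) * θ * I)))) := by
  have hpi := Real.pi_pos
  have hC : 0 < Real.cos θ := Real.cos_pos_of_mem_Ioo ⟨by linarith, by linarith⟩
  have hT : 0 < Real.tan θ := Real.tan_pos_of_pos_of_lt_pi_div_two h0 (by linarith)
  have hS : 0 < Real.sin (3 * θ) := Real.sin_pos_of_pos_of_lt_pi (by linarith) (by linarith)
  have hsin := sin_three_mul_eq_cos_cube_mul hC.ne'
  have hs3 : (0 : ℝ) < Real.sqrt 3 := by positivity
  have hy : (Real.sqrt 3 : ℂ) * I * Real.sqrt (Real.tan θ ^ 2 / 3) = Real.tan θ * I := by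
    rw [Real.sqrt_div (by positivity), Real.sqrt_sq hT.le]
    have : (Real.sqrt 3 : ℂ) ≠ 0 := Complex.ofReal_ne_zero.2 hs3.ne'
    push_cast
    field_simp
  have hp := one_add_tan_mul_I_cpow (θ := θ) (by linarith) (by linarith) (2 * (3 * t))
  have hm := one_add_tan_mul_I_cpow (θ := -θ) (by linarith) (by linarith) (2 * (3 * t))
  rw [Real.tan_neg, Real.cos_neg] at hm
  have hm' : (1 - Real.tan θ * I) ^ (-(2 * (3 * t))) =
      (Real.cos θ : ℂ) ^ (2 * (3 * t)) * exp (2 * (3 * t) * θ * I) := by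
    rw [show 1 - (Real.tan θ : ℂ) * I = 1 + ((-Real.tan θ : ℝ) : ℂ) * I by push_cast; ring, hm]
    push_cast
    ring_nf
  have h1u : 1 - ((Real.tan θ ^ 2 / 3 : ℝ) : ℂ) =
      ((Real.sin (3 * θ) / (Real.cos θ ^ 3 * Real.tan θ * 3) : ℝ) : ℂ) := by
    rw [hsin]
    have : (1 - Real.tan θ ^ 2 / 3 : ℝ) =
        Real.cos θ ^ 3 * (Real.tan θ * (3 - Real.tan θ ^ 2)) /
          (Real.cos θ ^ 3 * Real.tan θ * 3) := by
      field_simp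
    rw [← this]
    push_cast
    ring
  rw [hy, hp, hm', h1u]
  set C := Real.cos θ
  set T := Real.tan θ
  set S := Real.sin (3 * θ)
  have hpow : ∀ {x : ℝ}, 0 < x → ∀ s : ℂ, (x : ℂ) ^ s = exp (Real.log x * s) := fun hx s => by
    rw [Complex.cpow_def_of_ne_zero (Complex.ofReal_ne_zero.2 hx.ne'), Complex.ofReal_log hx.le]
  have hexp : ∀ {x : ℝ}, 0 < x → (x : ℂ) = exp (Real.log x) := fun hx => by
    rw [← Complex.ofReal_exp, Real.exp_log hx]
  have hl1 : Real.log (T ^ 2 / 3) = 2 * Real.log T - Real.log 3 := by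
    rw [Real.log_div (by positivity) (by norm_num), Real.log_pow]
    norm_num
  have hl2 : Real.log (S / (C ^ 3 * T * 3)) =
      Real.log S - (3 * Real.log C + Real.log T + Real.log 3) := by
    rw [Real.log_div hS.ne' (by positivity), Real.log_mul (by positivity) (by norm_num),
      Real.log_mul (by positivity) hT.ne', Real.log_pow]
    norm_num
  have hl3 : Real.log (T / C ^ 2) = Real.log T - 2 * Real.log C := by
    rw [Real.log_div hT.ne' (by positivity), Real.log_pow]
    norm_num
  -- Comparing logarithms: the exponent of T is 1 + 2(t-5/6) - (2t-2/3) = 0 and that of C is -2 -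
  -- 3(2t-2/3) + 6t = 0.
  have key : ((T / C ^ 2 : ℝ) : ℂ) * ((T ^ 2 / 3 : ℝ) : ℂ) ^ (t + 1 / 6 - 1) *
      ((S / (C ^ 3 * T * 3) : ℝ) : ℂ) ^ (2 * t - 2 / 3) * (C : ℂ) ^ (2 * (3 * t)) =
      (3 : ℂ) ^ (3 / 2 - 3 * t) * (S : ℂ) ^ (2 * t - 2 / 3) := by
    rw [show (3 : ℂ) = ((3 : ℝ) : ℂ) by norm_num, hexp (x := T / C ^ 2) (by positivity),
      hpow (x := T ^ 2 / 3) (by positivity), hpow (x := S / (C ^ 3 * T * 3)) (by positivity),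
      hpow hC, hpow hS, hpow (x := (3 : ℝ)) (by norm_num), hl1, hl2, hl3, ← Complex.exp_add,
      ← Complex.exp_add, ← Complex.exp_add, ← Complex.exp_add]
    congr 1
    push_cast
    ring
  rw [Complex.real_smul, show 2 / 3 * T / C ^ 2 = 2 / 3 * (T / C ^ 2) by ring, Complex.ofReal_mul,
    show 3 * (2 * t - 2 / 3) + 2 = 2 * (3 * t) by ring]
  push_cast at key ⊢
  linear_combination (2 / 3 * (exp (2 * (3 * t) * θ * I) + exp (-(2 * (3 * t) * θ * I)))) * key

theorem betaIntegral_mul_gaussF_neg_three {t : ℂ} (ht : 1 < t.re) :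
    2 * betaIntegral (t + 1 / 6) (2 * t - 2 / 3 + 1) *
      gaussF (3 * t) (t + 1 / 6) (1 / 2) (-3) * 2 ^ (2 * t - 2 / 3) =
      2 / 3 * (3 : ℂ) ^ (3 / 2 - 3 * t) * (Real.sqrt 3 / 3 *
        betaIntegral (1 / 3) (2 * t - 2 / 3 + 1) * cos (Real.pi * t)) := by
  have hpi := Real.pi_pos
  have hb : 1 < (t + 1 / 6).re := by
    simp
    linarith
  have hc : 0 < (2 * t - 2 / 3).re := by
    simp
    linarith
  have h3 : -((Real.sqrt 3 : ℝ) : ℂ) ^ 2 = -3 := by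
    rw [← Complex.ofReal_pow, Real.sq_sqrt (by norm_num)]
    norm_num
  have hrep := integral_one_add_cpow_eq (a := 3 * t) hb hc (by ring)
    (y := (Real.sqrt 3 : ℝ)) (by simp)
  rw [h3] at hrep
  have htrig := integral_sin_cpow_mul_exp_add_exp hc
  -- For c = 2t - 2/3 the phase in Cauchy's formula is exactly πt, the source of cos(πt).
  rw [show (Real.pi : ℂ) / 3 + (2 * t - 2 / 3) * Real.pi / 2 = Real.pi * t by ring] at htrig
  rw [← hrep, ← htrig, mul_comm _ ((2 : ℂ) ^ (2 * t - 2 / 3)),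
    mul_left_comm (2 / 3 * (3 : ℂ) ^ (3 / 2 - 3 * t))]
  congr 1
  have hcos : ∀ θ ∈ Set.uIcc 0 (Real.pi / 3), 0 < Real.cos θ := by
    intro θ hθ
    rw [Set.uIcc_of_le (by positivity)] at hθ
    exact Real.cos_pos_of_mem_Ioo ⟨by linarith [hθ.1], by linarith [hθ.2]⟩
  have himg : (fun θ : ℝ => Real.tan θ ^ 2 / 3) '' Set.uIcc 0 (Real.pi / 3) ⊆ Set.Icc 0 1 := by
    rintro _ ⟨θ, hθ, rfl⟩
    refine ⟨by positivity, ?_⟩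
    rw [Set.uIcc_of_le (by positivity)] at hθ
    have h1 : 0 ≤ Real.tan θ := Real.tan_nonneg_of_nonneg_of_le_pi_div_two hθ.1 (by linarith [hθ.2])
    have h2 : Real.tan θ ≤ Real.tan (Real.pi / 3) :=
      Real.strictMonoOn_tan.monotoneOn ⟨by linarith [hθ.1], by linarith [hθ.2]⟩
        ⟨by linarith, by linarith⟩ hθ.2
    rw [Real.tan_pi_div_three] at h2
    have h4 : Real.tan θ ^ 2 ≤ 3 := by
      have := pow_le_pow_left₀ h1 h2 2
      rwa [Real.sq_sqrt (by norm_num)] at this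
    simp only
    linarith
  have hsub := intervalIntegral.integral_deriv_smul_comp' (a := 0) (b := Real.pi / 3)
    (f := fun θ : ℝ => Real.tan θ ^ 2 / 3) (f' := fun θ => 2 / 3 * Real.tan θ / Real.cos θ ^ 2)
    (g := fun u : ℝ => (u : ℂ) ^ (t + 1 / 6 - 1) * (1 - u : ℂ) ^ (2 * t - 2 / 3) *
      ((1 + (Real.sqrt 3 : ℂ) * I * Real.sqrt u) ^ (-(2 * (3 * t))) +
        (1 - (Real.sqrt 3 : ℂ) * I * Real.sqrt u) ^ (-(2 * (3 * t)))))
    (fun θ hθ => by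
      have := ((Real.hasDerivAt_tan (hcos θ hθ).ne').pow 2).div_const 3
      refine this.congr_deriv ?_
      simp only [Nat.cast_ofNat, Nat.add_one_sub_one, pow_one]
      ring)
    (by
      refine ContinuousOn.div (continuousOn_const.mul fun θ hθ => ?_) (by fun_prop)
        fun θ hθ => pow_ne_zero 2 (hcos θ hθ).ne'
      exact (Real.continuousAt_tan.2 (hcos θ hθ).ne').continuousWithinAt)
    (by
      refine ContinuousOn.mono ?_ himg
      refine (continuous_beta_weight hb hc).continuousOn.mul (ContinuousOn.add ?_ ?_)
      · intro u hu
        exact ContinuousAt.continuousWithinAt (ContinuousAt.cpow (by fun_prop) continuousAt_const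
          (one_add_mul_I_sqrt_mem_slitPlane (by simp) hu))
      · intro u hu
        refine ContinuousAt.continuousWithinAt (ContinuousAt.cpow (by fun_prop) continuousAt_const
          ?_)
        have := one_add_mul_I_sqrt_mem_slitPlane (y := -(Real.sqrt 3 : ℂ)) (by simp) hu
        simpa [sub_eq_add_neg] using this)
  simp only [Real.tan_zero, Real.tan_pi_div_three, Function.comp_apply] at hsub
  rw [Real.sq_sqrt (by norm_num), zero_pow two_ne_zero, zero_div, div_self (by norm_num)] at hsub
  rw [← hsub, ← intervalIntegral.integral_const_mul]
  refine intervalIntegral.integral_congr_uIoo fun θ hθ => ?_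
  rw [Set.uIoo_of_le (by positivity)] at hθ
  exact integrand_tan_substitution hθ.1 hθ.2 t

/-! ### Gamma evaluation and extension to all t -/

theorem gaussF_neg_three_of_one_lt_re {t : ℂ} (ht : 1 < t.re) :
    gaussF (3 * t) (t + 1 / 6) (1 / 2) (-3) = cos (Real.pi * t) * (16 : ℂ) ^ (-t) *
      (Gamma (t + 1 / 2) * Gamma (1 / 3)) / (Gamma (t + 1 / 3) * Gamma (1 / 2)) := by
  have h := betaIntegral_mul_gaussF_neg_three ht
  have hv : 0 < (2 * t - 2 / 3 + 1).re := by
    simp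
    linarith
  have hB1 := Complex.Gamma_mul_Gamma_eq_betaIntegral (s := t + 1 / 6) (by simp; linarith) hv
  have hB2 := Complex.Gamma_mul_Gamma_eq_betaIntegral (s := 1 / 3) (by norm_num) hv
  have h1 := Gamma_mul_Gamma_add_third_mul_Gamma_add_two_thirds (s := t + 1 / 6)
    (by simp; linarith)
  have h2 := Complex.Gamma_mul_Gamma_add_half (t + 1 / 3)
  rw [show t + 1 / 6 + (2 * t - 2 / 3 + 1) = 3 * t + 1 / 2 by ring] at hB1
  rw [show 1 / 3 + (2 * t - 2 / 3 + 1) = 2 * t + 2 / 3 by ring] at hB2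
  rw [show t + 1 / 6 + 1 / 3 = t + 1 / 2 by ring, show t + 1 / 6 + 2 / 3 = t + 5 / 6 by ring,
    show 3 * (t + 1 / 6) = 3 * t + 1 / 2 by ring] at h1
  rw [show t + 1 / 3 + 1 / 2 = t + 5 / 6 by ring,
    show 2 * (t + 1 / 3) = 2 * t + 2 / 3 by ring] at h2
  have hs : (Real.pi : ℂ) = (Real.sqrt Real.pi : ℂ) ^ 2 := by
    rw [← Complex.ofReal_pow, Real.sq_sqrt Real.pi_pos.le]
  have e1 : (3 : ℂ) ^ (3 / 2 - 3 * t) = 9 * (1 / 3 : ℂ) ^ (3 * t + 1 / 2) := by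
    rw [one_div (3 : ℂ), Complex.inv_cpow _ _ (by
      rw [show (3 : ℂ) = ((3 : ℝ) : ℂ) by norm_num, Complex.arg_ofReal_of_nonneg (by norm_num)]
      exact Real.pi_pos.ne), ← Complex.cpow_neg,
      show 3 / 2 - 3 * t = 2 + -(3 * t + 1 / 2) by ring, Complex.cpow_add _ _ three_ne_zero]
    norm_num
  have e2 : (2 : ℂ) ^ (1 - (2 * t + 2 / 3)) = 2 * (16 : ℂ) ^ (-t) * 2 ^ (2 * t - 2 / 3) := by
    have h16 : (16 : ℂ) ^ (-t) = 2 ^ (4 * -t) := by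
      have := Complex.natCast_cpow_natCast_mul 2 4 (-t)
      norm_num at this ⊢
      exact this.symm
    rw [h16, show 1 - (2 * t + 2 / 3) = 1 + 4 * -t + (2 * t - 2 / 3) by ring,
      Complex.cpow_add _ _ two_ne_zero, Complex.cpow_add _ _ two_ne_zero, Complex.cpow_one]
  have hG12 : Gamma (1 / 2 : ℂ) = Real.sqrt Real.pi := by
    rw [Complex.Gamma_one_half_eq, Real.sqrt_eq_rpow, Complex.ofReal_cpow Real.pi_pos.le]
    norm_num
  have n1 : Gamma (t + 1 / 3) ≠ 0 := Complex.Gamma_ne_zero_of_re_pos (by simp; linarith)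
  have n2 : Gamma (2 * t + 2 / 3) ≠ 0 := Complex.Gamma_ne_zero_of_re_pos (by simp; linarith)
  have n3 : Gamma (3 * t + 1 / 2) ≠ 0 := Complex.Gamma_ne_zero_of_re_pos (by simp; linarith)
  have n4 : Gamma (t + 5 / 6) ≠ 0 := Complex.Gamma_ne_zero_of_re_pos (by simp; linarith)
  have n5 : Gamma (t + 1 / 6) ≠ 0 := Complex.Gamma_ne_zero_of_re_pos (by simp; linarith)
  have n6 : Gamma (2 * t - 2 / 3 + 1) ≠ 0 := Complex.Gamma_ne_zero_of_re_pos hv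
  have n7 : (Real.sqrt Real.pi : ℂ) ≠ 0 :=
    Complex.ofReal_ne_zero.2 (Real.sqrt_pos.2 Real.pi_pos).ne'
  have n8 : betaIntegral (t + 1 / 6) (2 * t - 2 / 3 + 1) ≠ 0 := fun h0 => by
    rw [h0, mul_zero] at hB1
    exact mul_ne_zero n5 n6 hB1
  have n9 : (2 : ℂ) ^ (2 * t - 2 / 3) ≠ 0 := by simp [Complex.cpow_eq_zero_iff]
  rw [hG12, eq_div_iff (mul_ne_zero n1 n7)]
  rw [e1] at h
  rw [e2] at h2
  rw [hs] at h1
  generalize Gamma (t + 1 / 6) = G1 at *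
  generalize Gamma (t + 1 / 2) = G2 at *
  generalize Gamma (t + 5 / 6) = G5 at *
  generalize Gamma (t + 1 / 3) = G3 at *
  generalize Gamma (3 * t + 1 / 2) = H at *
  generalize Gamma (2 * t + 2 / 3) = D at *
  generalize Gamma (2 * t - 2 / 3 + 1) = v at *
  generalize Gamma (1 / 3 : ℂ) = g at *
  generalize betaIntegral (t + 1 / 6) (2 * t - 2 / 3 + 1) = B1 at *
  generalize betaIntegral (1 / 3) (2 * t - 2 / 3 + 1) = B2 at *
  generalize gaussF (3 * t) (t + 1 / 6) (1 / 2) (-3) = F at *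
  generalize (2 : ℂ) ^ (2 * t - 2 / 3) = p at *
  generalize (1 / 3 : ℂ) ^ (3 * t + 1 / 2) = w at *
  generalize (16 : ℂ) ^ (-t) = z at *
  generalize cos (Real.pi * t) = k at *
  generalize (Real.sqrt Real.pi : ℂ) = s at *
  generalize (Real.sqrt 3 : ℂ) = r at *
  -- After clearing these nonvanishing factors, only a polynomial consequence of the Beta,
  -- triplication and duplication identities is left.
  refine mul_left_cancel₀ (mul_ne_zero (mul_ne_zero (mul_ne_zero (mul_ne_zero n8 n9) n3) n2) n4) ?_
  linear_combination (1 / 2 : ℂ) * (H * D * G5 * G3 * s * h - (2 * w * r * k * s * H * G5 * G3) * hB2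
    + (2 * p * k * z * g * D * G5 * G2) * hB1 + (2 * w * r * k * s * H * g * v) * h2
    - (2 * p * k * z * g * D * v) * h1)

/-- Reflection formula; at t = 1/2, 3/2, … both sides vanish. The excluded points are true
exceptions: Mathlib's `Gamma` is 0 at its poles, so the left side would be 0 while the right side is
not. -/
theorem cos_pi_mul_mul_Gamma_add_half {t : ℂ} (ht : ∀ n : ℕ, t ≠ -(1 / 2) - (n : ℂ)) :
    cos (Real.pi * t) * Gamma (t + 1 / 2) = Real.pi * (Gamma (1 / 2 - t))⁻¹ := by
  have hpi : (Real.pi : ℂ) ≠ 0 := Complex.ofReal_ne_zero.2 Real.pi_pos.ne'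
  by_cases hcos : cos (Real.pi * t) = 0
  · obtain ⟨k, hk⟩ := Complex.cos_eq_zero_iff.1 hcos
    have htk : t = k + 1 / 2 := by
      refine mul_left_cancel₀ hpi ?_
      rw [hk]
      ring
    obtain ⟨n, rfl | rfl⟩ : ∃ n : ℕ, k = n ∨ k = -(n + 1 : ℤ) := by
      rcases k with n | n
      · exact ⟨n, Or.inl rfl⟩
      · exact ⟨n, Or.inr (Int.negSucc_eq n)⟩
    · rw [hcos, show 1 / 2 - t = -(n : ℂ) by rw [htk]; push_cast; ring,
        Complex.Gamma_neg_nat_eq_zero]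
      simp
    · refine absurd ?_ (ht n)
      rw [htk]
      push_cast
      ring
  · have h := Complex.Gamma_mul_Gamma_one_sub (t + 1 / 2)
    rw [show 1 - (t + 1 / 2) = 1 / 2 - t by ring, mul_add,
      show (Real.pi : ℂ) * (1 / 2) = Real.pi / 2 by ring, Complex.sin_add_pi_div_two] at h
    have hne : Gamma (1 / 2 - t) ≠ 0 := fun h0 => by
      rw [h0, mul_zero] at h
      exact div_ne_zero hpi hcos h.symm
    rw [eq_div_iff hcos] at h
    rw [← div_eq_mul_inv, eq_div_iff hne]
    linear_combination h

theorem gaussF_neg_three (t : ℂ) :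
    gaussF (3 * t) (t + 1 / 6) (1 / 2) (-3) = (16 : ℂ) ^ (-t) *
      (Real.pi * (Gamma (1 / 2 - t))⁻¹) * Gamma (1 / 3) * (Gamma (t + 1 / 3))⁻¹ / Gamma (1 / 2) := by
  have hL : Differentiable ℂ fun t : ℂ => gaussF (3 * t) (t + 1 / 6) (1 / 2) (-3) :=
    differentiable_gaussF (by fun_prop) (by fun_prop) neg_three_mem_cutPlane
  have hR : Differentiable ℂ fun t : ℂ => (16 : ℂ) ^ (-t) *
      (Real.pi * (Gamma (1 / 2 - t))⁻¹) * Gamma (1 / 3) * (Gamma (t + 1 / 3))⁻¹ /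
      Gamma (1 / 2) := by
    have h1 : Differentiable ℂ fun t : ℂ => (Gamma (1 / 2 - t))⁻¹ :=
      Complex.differentiable_one_div_Gamma.comp (by fun_prop : Differentiable ℂ fun t : ℂ => 1 / 2 - t)
    have h2 : Differentiable ℂ fun t : ℂ => (Gamma (t + 1 / 3))⁻¹ :=
      Complex.differentiable_one_div_Gamma.comp (by fun_prop : Differentiable ℂ fun t : ℂ => t + 1 / 3)
    have h3 : Differentiable ℂ fun t : ℂ => (16 : ℂ) ^ (-t) := fun t =>
      (differentiableAt_id.neg).const_cpow (Or.inl (by norm_num))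
    exact (((h3.mul (h1.const_mul _)).mul_const _).mul h2).div_const _
  refine (hL.differentiableOn.analyticOnNhd isOpen_univ).eqOn_of_preconnected_of_eventuallyEq
    (hR.differentiableOn.analyticOnNhd isOpen_univ) isPreconnected_univ (Set.mem_univ (2 : ℂ)) ?_
    (Set.mem_univ t)
  have ho : IsOpen {t : ℂ | 1 < t.re} := isOpen_lt continuous_const Complex.continuous_re
  filter_upwards [ho.mem_nhds (by simp : (2 : ℂ) ∈ {t : ℂ | 1 < t.re})] with s hs
  have hs : 1 < s.re := hs
  have hsn : ∀ n : ℕ, s ≠ -(1 / 2) - (n : ℂ) := fun n h => by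
    have := congrArg Complex.re h
    simp at this
    have hn : (0 : ℝ) ≤ n := Nat.cast_nonneg n
    linarith
  rw [gaussF_neg_three_of_one_lt_re hs, ← cos_pi_mul_mul_Gamma_add_half hsn]
  field_simp

theorem mainTheorem7 :
    (∀ t : ℂ, ∃ G : ℂ → ℂ, IsGaussContinuation (3 * t) (t + 1 / 6) (1 / 2) G) ∧
    (∀ t : ℂ, (∀ n : ℕ, t ≠ -(1 / 2) - (n : ℂ)) →
      gaussF (3 * t) (t + 1 / 6) (1 / 2) (-3) =
        Complex.cos ((Real.pi : ℂ) * t) * (16 : ℂ) ^ (-t) *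
          (Complex.Gamma (t + 1 / 2) * Complex.Gamma (1 / 3)) /
          (Complex.Gamma (t + 1 / 3) * Complex.Gamma (1 / 2))) ∧
    (∀ t : ℂ, (∃ n : ℕ, t = -(1 / 2) - (n : ℂ)) →
      Tendsto
        (fun s : ℂ => Complex.cos ((Real.pi : ℂ) * s) * (16 : ℂ) ^ (-s) *
          (Complex.Gamma (s + 1 / 2) * Complex.Gamma (1 / 3)) /
          (Complex.Gamma (s + 1 / 3) * Complex.Gamma (1 / 2)))
        (𝓝[≠] t) (𝓝 (gaussF (3 * t) (t + 1 / 6) (1 / 2) (-3)))) := by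
  have hmain : ∀ t : ℂ, (∀ n : ℕ, t ≠ -(1 / 2) - (n : ℂ)) →
      gaussF (3 * t) (t + 1 / 6) (1 / 2) (-3) =
        Complex.cos ((Real.pi : ℂ) * t) * (16 : ℂ) ^ (-t) *
          (Complex.Gamma (t + 1 / 2) * Complex.Gamma (1 / 3)) /
          (Complex.Gamma (t + 1 / 3) * Complex.Gamma (1 / 2)) := by
    intro t ht
    -- At poles of Γ(t+1/3) the quotient is 0 because `Gamma` takes the value 0 there, which agrees
    -- with the entire function 1/Γ.
    rw [gaussF_neg_three, ← cos_pi_mul_mul_Gamma_add_half ht, div_mul_eq_div_div]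
    ring
  refine ⟨fun t => ⟨_, isGaussContinuation_discSum _ _⟩, hmain, ?_⟩
  rintro t ⟨n, rfl⟩
  have hcont : Continuous fun t : ℂ => gaussF (3 * t) (t + 1 / 6) (1 / 2) (-3) :=
    (differentiable_gaussF (by fun_prop) (by fun_prop) neg_three_mem_cutPlane).continuous
  refine ((hcont.tendsto _).mono_left nhdsWithin_le_nhds).congr' ?_
  -- Exceptional points differ by integers, so the punctured unit ball around one contains no other.
  filter_upwards [self_mem_nhdsWithin, nhdsWithin_le_nhds (Metric.ball_mem_nhds _ one_pos)]
    with s hs hs1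
  refine hmain s fun m hm => hs ?_
  rw [hm, Metric.mem_ball, dist_eq_norm,
    show -(1 / 2) - (m : ℂ) - (-(1 / 2) - (n : ℂ)) = ((n - m : ℤ) : ℂ) by push_cast; ring,
    Complex.norm_intCast] at hs1
  have hnm : |(n : ℤ) - m| < 1 := by exact_mod_cast hs1
  have hnm' : (n : ℤ) = m := by
    rw [Int.abs_lt_one_iff] at hnm
    lia
  rw [hm, show n = m by exact_mod_cast hnm']
  rfl
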